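/- Let $k\ge 1$ and ${\bf n}=(n_1,\dots,n_k)$ with all $n_i\ge 1$. For a complex Hilbert space $\mathcal H$, the regular polyball ${\bf B_n}(\mathcal H)$ is the set of tuples ${\bf X}=(X_1,\dots,X_k)$, $X_i=(X_{i,1},\dots,X_{i,n_i})\in B(\mathcal H)^{n_i}$, such that the entries of $X_s$ commute with the entries of $X_t$ for $s\neq t$, $\|\sum_j X_{i,j}X_{i,j}^*\|^{1/2}<1$ for every $i$, and ${\bf \Delta_X}(I):=(\mathrm{id}-\Phi_{X_1})\circ\cdots\circ(\mathrm{id}-\Phi_{X_k})(I)$ is positive and invertible, where $\Phi_{X_i}(Y)=\sum_j X_{i,j}YX_{i,j}^*$. Let $\mathbb F_{n_i}^+$ be the free monoid on $n_i$ generators; for $\boldsymbol\alpha=(\alpha_1,\dots,\alpha_k)\in\mathbb F_{n_1}^+\times\cdots\times\mathbb F_{n_k}^+$ put ${\bf X}_{\boldsymbol\alpha}=X_{1,\alpha_1}\cdots X_{k,\alpha_k}$, where $X_{i,\alpha_i}$ is the product of the $X_{i,j}$ along the word $\alpha_i$. Let $\Lambda_{\bf p}=\{\boldsymbol\alpha:|\alpha_i|=p_i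 \text{ for all } i\}$ for ${\bf p}\in\mathbb Z_+^k$ and $\Gamma_m=\{\boldsymbol\alpha:|\alpha_1|+\cdots+|\alpha_k|=m\}$ for $m\ge 0$. A free holomorphic function $F$ with coefficients $A_{(\boldsymbol\alpha)}\in B(\mathcal K)$, $\mathcal K$ a complex Hilbert space, is a formal power series for which $$F({\bf X}):=\sum_{{\bf p}\in\mathbb Z_+^k}\ \sum_{\boldsymbol\alpha\in\Lambda_{\bf p}}A_{(\boldsymbol\alpha)}\otimes {\bf X}_{\boldsymbol\alpha}$$ converges (unconditionally) in the operator norm of $B(\mathcal K\otimes\mathcal H)$ for every Hilbert space $\mathcal H$ and every ${\bf X}\in{\bf B_n}(\mathcal H)$. Put $\|F\|_\infty=\sup\|F({\bf X})\|$ over all $\mathcal H$ and all ${\bf X}\in {\bf B_n}(\mathcal H)$; $F$ is bounded if $\|F\|_\infty<\infty$. For scalar coefficients $a_{(\boldsymbol\alpha)}\in\mathbb C$ the same definitions are used with $a_{(\boldsymbol\alpha)}{\bf X}_{\boldsymbol\alpha}\in B(\mathcal H)$, and $H^\infty({\bf B_n})$ denotes the set of bounded free holomorphic functions with scalar coefficients.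 $F$ is constant if $F({\bf X})=C\otimes I_{\mathcal H}$ (respectively $F({\bf X})=cI_{\mathcal H}$) for all $\mathcal H$ and all ${\bf X}\in{\bf B_n}(\mathcal H)$, with a fixed $C\in B(\mathcal K)$ (respectively $c\in\mathbb C$). **(1)** Let $F$ be a bounded free holomorphic function with coefficients in $B(\mathcal K)$ such that $F(0)=a_0I$ for some $a_0\in\mathbb C$. Then, for every $\mathcal H$ and every ${\bf X}\in\frac13{\bf B_n}(\mathcal H)$, $$\sum_{m=0}^\infty\Big\|\sum_{\boldsymbol\alpha\in\Gamma_m}A_{(\boldsymbol\alpha)}\otimes{\bf X}_{\boldsymbol\alpha}\Big\|\le\|F\|_\infty,$$ and the inequality is strict unless $F$ is constant. The constant $\frac13$ is best possible: for all $\mathcal K\ne 0$, $\mathcal H\neq 0$ and $r>\frac13$ there are such an $F$ and an ${\bf X}\in r{\bf B_n}(\mathcal H)$ for which the left-hand side is greater than $\|F\|_\infty$. **(2)** For every $F\in H^\infty({\bf B_n})$, every $\mathcal H$ and every ${\bf X}\in\frac13{\bf B_n}(\mathcal H)$, $$\sum_{m=0}^\infty\Big\|\sum_{\boldsymbol\alpha\in\Gamma_m}a_{(\boldsymbol\alpha)}{\bf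 X}_{\boldsymbol\alpha}\Big\|\le\|F\|_\infty,$$ and the inequality is strict unless $F$ is constant. The constant $\frac13$ is best possible: for all $\mathcal H\neq 0$ and $r>\frac13$ there are $F\in H^\infty({\bf B_n})$ and ${\bf X}\in r{\bf B_n}(\mathcal H)$ for which the left-hand side is greater than $\|F\|_\infty$. **(3)** Let $K_h({\bf B_n})$ be the largest $r\ge 0$ such that $\sum_{m=0}^\infty\|\sum_{\boldsymbol\alpha\in\Gamma_m}a_{(\boldsymbol\alpha)}{\bf X}_{\boldsymbol\alpha}\|\le\|F\|_\infty$ for all $F\in H^\infty({\bf B_n})$, all $\mathcal H$ and all ${\bf X}\in r\,{\bf B_n}(\mathcal H)^-$ (norm closure). This largest $r$ exists, and $K_h({\bf B_n})=\frac13$. -/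

import Mathlib

open scoped ENNReal TensorProduct Pointwise

universe u v

noncomputable section

namespace RegularPolyball

/-- `Words n` is the product `𝔽⁺_{n_1} × ⋯ × 𝔽⁺_{n_k}` of unital free semigroups. -/
abbrev Words {k : ℕ} (n : Fin k → ℕ) : Type := ∀ i : Fin k, FreeMonoid (Fin (n i))

/-- `Λ_p`: the multi-words `α` with `|α_i| = p_i` for every `i`. -/
def multiDegreeSet {k : ℕ} (n : Fin k → ℕ) (p : Fin k → ℕ) : Set (Words n) :=
  {α | ∀ i, (α i).length = p i}

/-- `Γ_m`: the multi-words `α` with `|α_1| + ⋯ + |α_k| = m`. -/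
def degreeSet {k : ℕ} (n : Fin k → ℕ) (m : ℕ) : Set (Words n) :=
  {α | ∑ i, (α i).length = m}

theorem multiDegreeSet_finite {k : ℕ} (n : Fin k → ℕ) (p : Fin k → ℕ) :
    (multiDegreeSet n p).Finite := by
  have h : (Set.univ.pi fun i : Fin k =>
      {w : FreeMonoid (Fin (n i)) | w.length = p i}).Finite :=
    Set.Finite.pi fun i => List.finite_length_eq (Fin (n i)) (p i)
  refine h.subset fun α hα => ?_
  intro i _
  exact hα i

theorem degreeSet_finite {k : ℕ} (n : Fin k → ℕ) (m : ℕ) : (degreeSet n m).Finite := by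
  have h : (Set.univ.pi fun i : Fin k =>
      {w : FreeMonoid (Fin (n i)) | w.length ≤ m}).Finite :=
    Set.Finite.pi fun i => List.finite_length_le (Fin (n i)) m
  refine h.subset fun α hα => ?_
  intro i _
  have hα' : ∑ i, (α i).length = m := hα
  have := Finset.single_le_sum (f := fun i => (α i).length) (fun _ _ => Nat.zero_le _)
    (Finset.mem_univ i)
  exact hα' ▸ this

/-- `Λ_p` as a finite set. -/
def Lam {k : ℕ} (n : Fin k → ℕ) (p : Fin k → ℕ) : Finset (Words n) :=
  (multiDegreeSet_finite n p).toFinset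

/-- `Γ_m` as a finite set. -/
def Gam {k : ℕ} (n : Fin k → ℕ) (m : ℕ) : Finset (Words n) :=
  (degreeSet_finite n m).toFinset

section Operators

variable {k : ℕ} {n : Fin k → ℕ} {H : Type u} [NormedAddCommGroup H] [InnerProductSpace ℂ H]

/-- Tuples `X = (X_1, …, X_k)` with `X_i = (X_{i,1}, …, X_{i,n_i}) ∈ B(H)^{n_i}`. -/
abbrev Tuple (n : Fin k → ℕ) (H : Type u) [NormedAddCommGroup H] [InnerProductSpace ℂ H] :
    Type u :=
  ∀ i : Fin k, Fin (n i) → (H →L[ℂ] H)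

/-- `X_α = X_{1,α_1} ⋯ X_{k,α_k}`, where `X_{i,α_i}` is the product of the `X_{i,j}` along the
word `α_i`. -/
def monomial (X : Tuple n H) (α : Words n) : H →L[ℂ] H :=
  (List.ofFn fun i : Fin k => FreeMonoid.lift (X i) (α i)).prod

variable [CompleteSpace H]

/-- The completely positive map `Φ_T(Y) = ∑_j T_j Y T_j^*`. -/
def Phi {m : ℕ} (T : Fin m → (H →L[ℂ] H)) : Module.End ℂ (H →L[ℂ] H) where
  toFun Y := ∑ j, T j * Y * star (T j)
  map_add' Y Z := by simp only [mul_add, add_mul, Finset.sum_add_distrib]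
  map_smul' c Y := by
    simp only [mul_smul_comm, smul_mul_assoc, Finset.smul_sum, RingHom.id_apply]

/-- The defect mapping `Δ_X = (id - Φ_{X_1}) ∘ ⋯ ∘ (id - Φ_{X_k})`. -/
def Defect (X : Tuple n H) : Module.End ℂ (H →L[ℂ] H) :=
  (List.ofFn fun i : Fin k => LinearMap.id - Phi (X i)).prod

variable (n H) in
/-- The regular polyball `B_n(H)`: tuples of strict row contractions `X_1, …, X_k`, the entries of
`X_s` commuting with those of `X_t` for `s ≠ t`, whose defect operator `Δ_X(I)` is positive and
invertible. -/
def polyball : Set (Tuple n H) :=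
  {X | (∀ s t : Fin k, s ≠ t → ∀ i j, X s i * X t j = X t j * X s i) ∧
    (∀ i, Real.sqrt ‖∑ j, X i j * star (X i j)‖ < 1) ∧
    (Defect X 1).IsPositive ∧ IsUnit (Defect X 1)}

end Operators

/-! ### Free holomorphic functions with operator coefficients -/

section OperatorCoefficients

variable {k : ℕ} {n : Fin k → ℕ}
variable {K : Type v} [NormedAddCommGroup K] [InnerProductSpace ℂ K]

section Values

variable {H : Type u} [NormedAddCommGroup H] [InnerProductSpace ℂ H]

/-- The Hilbert tensor product `K ⊗ H`: the completion of the algebraic tensor product for the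
inner product `⟪a ⊗ b, c ⊗ d⟫ = ⟪a, c⟫ ⟪b, d⟫`. -/
abbrev HTensor (K : Type v) (H : Type u) [NormedAddCommGroup K] [InnerProductSpace ℂ K]
    [NormedAddCommGroup H] [InnerProductSpace ℂ H] : Type (max u v) :=
  UniformSpace.Completion (K ⊗[ℂ] H)

/-- The operator `A ⊗ T` on the Hilbert tensor product `K ⊗ H`. -/
def opTensor (A : K →L[ℂ] K) (T : H →L[ℂ] H) : HTensor K H →L[ℂ] HTensor K H :=
  (TensorProduct.mapL A T).completion

/-- The homogeneous part `∑_{α ∈ Γ_m} A_α ⊗ X_α`. -/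
def homPart (A : Words n → (K →L[ℂ] K)) (X : Tuple n H) (m : ℕ) :
    HTensor K H →L[ℂ] HTensor K H :=
  ∑ α ∈ Gam n m, opTensor (A α) (monomial X α)

/-- The multi-homogeneous part `∑_{α ∈ Λ_p} A_α ⊗ X_α`. -/
def multiHomPart (A : Words n → (K →L[ℂ] K)) (X : Tuple n H) (p : Fin k → ℕ) :
    HTensor K H →L[ℂ] HTensor K H :=
  ∑ α ∈ Lam n p, opTensor (A α) (monomial X α)

/-- The value `F(X) = ∑_p ∑_{α ∈ Λ_p} A_α ⊗ X_α` (sum in the operator norm). -/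
def value (A : Words n → (K →L[ℂ] K)) (X : Tuple n H) : HTensor K H →L[ℂ] HTensor K H :=
  ∑' p : Fin k → ℕ, multiHomPart A X p

end Values

/-- The formal power series `∑ A_α ⊗ Z_α` is a free holomorphic function on the abstract polyball:
its multi-homogeneous expansion converges in the operator norm at every point of `B_n(H)`, for
every Hilbert space `H`. -/
def IsFreeHolomorphic (A : Words n → (K →L[ℂ] K)) : Prop :=
  ∀ (H : Type u) [NormedAddCommGroup H] [InnerProductSpace ℂ H] [CompleteSpace H],
    ∀ X ∈ polyball n H, Summable fun p : Fin k → ℕ => multiHomPart A X p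

/-- `‖F‖_∞`, the supremum of `‖F(X)‖` over all `X ∈ B_n(H)` and all Hilbert spaces `H`. -/
def supNorm (A : Words n → (K →L[ℂ] K)) : ℝ≥0∞ :=
  ⨆ (H : Type u) (_ : NormedAddCommGroup H) (_ : InnerProductSpace ℂ H) (_ : CompleteSpace H)
    (X : Tuple n H) (_ : X ∈ polyball n H), ‖value A X‖ₑ

/-- A bounded free holomorphic function with operator coefficients. -/
def IsBoundedFreeHolomorphic (A : Words n → (K →L[ℂ] K)) : Prop :=
  IsFreeHolomorphic.{u, v} A ∧ supNorm.{u, v} A < ∞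

/-- `F(0) = a₀ I` for some scalar `a₀`. -/
def IsScalarAtZero (A : Words n → (K →L[ℂ] K)) : Prop :=
  ∃ a₀ : ℂ, ∀ (H : Type u) [NormedAddCommGroup H] [InnerProductSpace ℂ H] [CompleteSpace H],
    value A (0 : Tuple n H) = a₀ • (1 : HTensor K H →L[ℂ] HTensor K H)

/-- `F` is a constant function: `F(X) = C ⊗ I` on the whole polyball. -/
def IsConstant (A : Words n → (K →L[ℂ] K)) : Prop :=
  ∃ C : K →L[ℂ] K,
    ∀ (H : Type u) [NormedAddCommGroup H] [InnerProductSpace ℂ H] [CompleteSpace H],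
      ∀ X ∈ polyball n H, value A X = opTensor C (1 : H →L[ℂ] H)

end OperatorCoefficients

/-! ### Free holomorphic functions with scalar coefficients -/

section ScalarCoefficients

namespace Scalar

variable {k : ℕ} {n : Fin k → ℕ}

section Values

variable {H : Type u} [NormedAddCommGroup H] [InnerProductSpace ℂ H]

/-- The homogeneous part `∑_{α ∈ Γ_m} a_α X_α`. -/
def homPart (a : Words n → ℂ) (X : Tuple n H) (m : ℕ) : H →L[ℂ] H :=
  ∑ α ∈ Gam n m, a α • monomial X α

/-- The multi-homogeneous part `∑_{α ∈ Λ_p} a_α X_α`. -/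
def multiHomPart (a : Words n → ℂ) (X : Tuple n H) (p : Fin k → ℕ) : H →L[ℂ] H :=
  ∑ α ∈ Lam n p, a α • monomial X α

/-- The value `F(X) = ∑_p ∑_{α ∈ Λ_p} a_α X_α` (sum in the operator norm). -/
def value (a : Words n → ℂ) (X : Tuple n H) : H →L[ℂ] H :=
  ∑' p : Fin k → ℕ, multiHomPart a X p

end Values

/-- The formal power series `∑ a_α Z_α` is a free holomorphic function on the polyball. -/
def IsFreeHolomorphic (a : Words n → ℂ) : Prop :=
  ∀ (H : Type u) [NormedAddCommGroup H] [InnerProductSpace ℂ H] [CompleteSpace H],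
    ∀ X ∈ polyball n H, Summable fun p : Fin k → ℕ => multiHomPart a X p

/-- `‖F‖_∞`, the supremum of `‖F(X)‖` over all `X ∈ B_n(H)` and all Hilbert spaces `H`. -/
def supNorm (a : Words n → ℂ) : ℝ≥0∞ :=
  ⨆ (H : Type u) (_ : NormedAddCommGroup H) (_ : InnerProductSpace ℂ H) (_ : CompleteSpace H)
    (X : Tuple n H) (_ : X ∈ polyball n H), ‖value a X‖ₑ

/-- Membership in the Hardy space `H^∞(B_n)` of bounded free holomorphic functions with scalar
coefficients. -/
def MemHardy (a : Words n → ℂ) : Prop :=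
  IsFreeHolomorphic.{u} a ∧ supNorm.{u} a < ∞

/-- `F` is a constant function: `F(X) = c I` on the whole polyball. -/
def IsConstant (a : Words n → ℂ) : Prop :=
  ∃ c : ℂ, ∀ (H : Type u) [NormedAddCommGroup H] [InnerProductSpace ℂ H] [CompleteSpace H],
    ∀ X ∈ polyball n H, value a X = c • (1 : H →L[ℂ] H)

end Scalar

/-- The radii `r ≥ 0` such that `∑_m ‖∑_{α ∈ Γ_m} a_α X_α‖ ≤ ‖F‖_∞` for every
`F ∈ H^∞(B_n)` and every `X ∈ r B_n(H)^-`, for all Hilbert spaces `H`. -/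
def bohrSet {k : ℕ} (n : Fin k → ℕ) : Set ℝ :=
  {r | 0 ≤ r ∧ ∀ a : Words n → ℂ, Scalar.MemHardy.{u} a →
    ∀ (H : Type u) [NormedAddCommGroup H] [InnerProductSpace ℂ H] [CompleteSpace H],
      ∀ X ∈ (r : ℂ) • closure (polyball n H),
        ∑' m : ℕ, ‖Scalar.homPart a X m‖ₑ ≤ Scalar.supNorm.{u} a}

/-- The Bohr radius `K_h(B_n)`. -/
def bohrRadius {k : ℕ} (n : Fin k → ℕ) : ℝ := sSup (bohrSet.{u} n)

end ScalarCoefficients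

end RegularPolyball

end

/-!
For `X` in the polyball the whole circle `{w X : |w| = 1}` lies in the polyball, and
`F(w X) = ∑ w ^ m F_m(X)` is there a bounded operator-valued power series, with `F_m` the homogeneous
parts of `F`. Put `M = ‖F‖_∞`. Sampling at the `N`-th roots of unity and letting `N → ∞` recovers the
coefficients `F_m(X)` (`tendsto_rootAverage`); only unconditional convergence is available, so no
absolutely convergent expansion is used. Bessel's inequality for the function
`w ↦ F(w X) (x + w ^ m y)` gives

  `‖F_0 x‖ ^ 2 + ‖F_m x + F_0 y‖ ^ 2 ≤ M ^ 2 (‖x‖ ^ 2 + ‖y‖ ^ 2)`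

(`norm_sq_coeff_add_le`). When `F_0 = a I`, the best choice of `y` as a multiple of `F_m x` turns
this into `M ‖F_m(X)‖ ≤ M ^ 2 - |a| ^ 2` (`mul_norm_coeff_le`), the operator form of the
Schwarz–Pick coefficient bound. Summing with weights `3 ^ (-m)` yields
`|a| + (M ^ 2 - |a| ^ 2) / (2 M) ≤ M`, with equality only if `|a| = M`; in that case all higher
homogeneous parts vanish and `F` is constant. Operator and scalar coefficients are treated together
by letting the terms of the series be arbitrary linear functions of the monomials (`degreePart`).
The closed ball needs only continuity of the finitely many monomials in each partial sum.

For the sharpness of `1 / 3`, the disc automorphism `φ(z) = (a - z) / (1 - a z)` is evaluated at the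
single entry `X_{1,1}`, a strict contraction. Von Neumann's inequality for `φ` is a direct
computation (`hasSum_mobiusCoeff_smul_pow`), so `‖F‖_∞ ≤ 1`, while at `X_{1,1} = ρ I` the majorant
series exceeds `1` as soon as `ρ (1 + 2 a) > 1` (`one_lt_tsum_mobiusCoeff`). This is possible with
some `a < 1` exactly when `ρ > 1 / 3`.
-/

namespace RegularPolyball

open Filter Topology Finset

/-! ### Averages over roots of unity -/

/-- Bessel's inequality for the two orthogonal characters `1` and `u` of a finite averaging
set. -/
theorem norm_sq_sum_add_norm_sq_sum_le {ι E : Type*} [NormedAddCommGroup E]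
    [InnerProductSpace ℂ E] (s : Finset ι) (u : ι → ℂ) (hu : ∀ j ∈ s, ‖u j‖ = 1)
    (hsum : ∑ j ∈ s, u j = 0) (g : ι → E) :
    ‖∑ j ∈ s, g j‖ ^ 2 + ‖∑ j ∈ s, star (u j) • g j‖ ^ 2 ≤ #s * ∑ j ∈ s, ‖g j‖ ^ 2 := by
  rcases s.eq_empty_or_nonempty with rfl | hs
  · simp
  set P := ∑ j ∈ s, g j with hP
  set Q := ∑ j ∈ s, star (u j) • g j with hQ
  have hpos : (0 : ℝ) < #s := by exact_mod_cast hs.card_pos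
  have key : ∀ j ∈ s, ‖((#s : ℝ) : ℂ) • g j - (P + u j • Q)‖ ^ 2 =
      (#s : ℝ) ^ 2 * ‖g j‖ ^ 2
        - 2 * #s * ((inner ℂ P (g j)).re + (inner ℂ Q (star (u j) • g j)).re)
        + (‖P‖ ^ 2 + 2 * (u j * inner ℂ P Q).re + ‖Q‖ ^ 2) := by
    intro j hj
    have h1 : ‖P + u j • Q‖ ^ 2 = ‖P‖ ^ 2 + 2 * (u j * inner ℂ P Q).re + ‖Q‖ ^ 2 := by
      rw [norm_add_sq (𝕜 := ℂ), inner_smul_right, norm_smul, hu j hj, one_mul]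
      rfl
    rw [norm_sub_sq (𝕜 := ℂ), h1, norm_smul, Complex.norm_real, Real.norm_of_nonneg hpos.le,
      inner_re_symm, inner_add_left, inner_smul_right, inner_smul_right, inner_smul_left,
      inner_smul_right]
    simp
    ring
  have h0 : 0 ≤ ∑ j ∈ s, ‖((#s : ℝ) : ℂ) • g j - (P + u j • Q)‖ ^ 2 :=
    sum_nonneg fun _ _ => by positivity
  rw [sum_congr rfl key, sum_add_distrib, sum_sub_distrib, ← mul_sum, ← mul_sum,
    sum_add_distrib, sum_add_distrib, sum_add_distrib, ← mul_sum, ← Complex.re_sum,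
    ← Complex.re_sum, ← Complex.re_sum, ← inner_sum, ← inner_sum, ← hP, ← hQ, ← sum_mul, hsum,
    inner_self_eq_norm_sq_to_K, inner_self_eq_norm_sq_to_K] at h0
  simp only [sum_const, nsmul_eq_mul, zero_mul, Complex.zero_re, mul_zero, add_zero,
    Complex.coe_algebraMap, ← Complex.ofReal_pow, Complex.ofReal_re] at h0
  refine le_of_mul_le_mul_left ?_ hpos
  linarith

/-- The standard primitive `N`-th root of unity. -/
noncomputable def rootUnity (N : ℕ) : ℂ := Complex.exp (2 * Real.pi * Complex.I / N)

theorem rootUnity_isPrimitiveRoot {N : ℕ} (hN : N ≠ 0) : IsPrimitiveRoot (rootUnity N) N :=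
  Complex.isPrimitiveRoot_exp N hN

theorem rootUnity_ne_zero (N : ℕ) : rootUnity N ≠ 0 := Complex.exp_ne_zero _

theorem norm_rootUnity_pow (N j : ℕ) : ‖rootUnity N ^ j‖ = 1 := by
  have : rootUnity N = Complex.exp ((2 * Real.pi / N : ℝ) * Complex.I) := by
    rw [rootUnity]; congr 1; push_cast; ring
  rw [norm_pow, this, Complex.norm_exp_ofReal_mul_I, one_pow]

theorem sum_rootUnity_zpow {N : ℕ} (hN : N ≠ 0) (l : ℤ) :
    ∑ j ∈ range N, (rootUnity N ^ j) ^ l = if (N : ℤ) ∣ l then (N : ℂ) else 0 := by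
  have hζ := rootUnity_isPrimitiveRoot hN
  have hcomm : ∀ j : ℕ, (rootUnity N ^ j) ^ l = (rootUnity N ^ l) ^ j := fun j => by
    rw [← zpow_natCast, ← zpow_natCast, ← zpow_mul, ← zpow_mul, mul_comm]
  simp only [hcomm]
  split_ifs with h
  · rw [(hζ.zpow_eq_one_iff_dvd l).2 h]; simp
  · have h1 : rootUnity N ^ l ≠ 1 := fun h' => h ((hζ.zpow_eq_one_iff_dvd l).1 h')
    rw [geom_sum_eq h1, ← hcomm, hζ.pow_eq_one]; simp

/-- The discrete Fourier coefficient of order `l` of a function `G` on the unit circle, sampled at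
the `N`-th roots of unity. -/
noncomputable def rootAverage {V : Type*} [AddCommGroup V] [Module ℂ V] (G : ℂ → V) (l : ℤ)
    (N : ℕ) : V :=
  (N : ℂ)⁻¹ • ∑ j ∈ range N, (rootUnity N ^ j) ^ (-l) • G (rootUnity N ^ j)

/-- The discrete Fourier coefficients of an unconditionally convergent power series on the unit
circle converge to its coefficients. -/
theorem tendsto_rootAverage {V : Type*} [NormedAddCommGroup V] [NormedSpace ℂ V]
    [CompleteSpace V] {F : ℕ → V} (hF : Summable F) {G : ℂ → V}
    (hG : ∀ w : ℂ, ‖w‖ = 1 → HasSum (fun d => w ^ d • F d) (G w)) (l : ℤ) :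
    Tendsto (rootAverage G l) atTop (𝓝 (if 0 ≤ l then F l.toNat else 0)) := by
  have hsum : ∀ N : ℕ, N ≠ 0 →
      HasSum ({d : ℕ | (N : ℤ) ∣ d - l}.indicator F) (rootAverage G l N) := by
    intro N hN
    have hN' : (N : ℂ) ≠ 0 := by exact_mod_cast hN
    have h := (hasSum_sum fun j (_ : j ∈ range N) =>
      (hG _ (norm_rootUnity_pow N j)).const_smul ((rootUnity N ^ j) ^ (-l))).const_smul (N : ℂ)⁻¹
    rw [rootAverage]
    convert h using 1
    funext d
    have h2 : ∀ j ∈ range N, (rootUnity N ^ j) ^ (-l) • (rootUnity N ^ j) ^ d • F d =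
        (rootUnity N ^ j) ^ ((d : ℤ) - l) • F d := fun j _ => by
      rw [smul_smul, ← zpow_natCast (rootUnity N ^ j) d,
        ← zpow_add₀ (pow_ne_zero _ (rootUnity_ne_zero N)), neg_add_eq_sub]
    rw [sum_congr rfl h2, ← sum_smul, sum_rootUnity_zpow hN, Set.indicator_apply]
    simp only [Set.mem_ofPred_eq]
    split_ifs
    · rw [smul_smul, inv_mul_cancel₀ hN', one_smul]
    · simp
  rw [Metric.tendsto_atTop]
  intro ε hε
  obtain ⟨s, hs⟩ := hF.tsum_vanishing (Metric.ball_mem_nhds 0 hε)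
  refine ⟨s.sup id + l.natAbs + 1, fun N hN => ?_⟩
  have hN0 : N ≠ 0 := by omega
  -- For large `N` the only index `≡ l` mod `N` that can meet `s` is `l` itself.
  set t : Set ℕ := {d : ℕ | (N : ℤ) ∣ d - l ∧ (d : ℤ) ≠ l} with ht
  have hdisj : Disjoint t ↑s := by
    rw [Set.disjoint_left]
    rintro d ⟨hd, hdl⟩ hds
    have h1 : d ≤ s.sup id := le_sup (f := id) hds
    have h2 := Int.le_of_dvd (b := |(d : ℤ) - l|) (abs_pos.2 (sub_ne_zero.2 hdl))
      ((dvd_abs _ _).2 hd)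
    rcases abs_cases ((d : ℤ) - l) with h3 | h3 <;> omega
  have hsplit : {d : ℕ | (N : ℤ) ∣ d - l}.indicator F =
      t.indicator F + {d : ℕ | (d : ℤ) = l}.indicator F := by
    funext d
    by_cases h : (d : ℤ) = l <;> by_cases h' : (N : ℤ) ∣ d - l <;>
      simp_all
  have hsing : HasSum ({d : ℕ | (d : ℤ) = l}.indicator F) (if 0 ≤ l then F l.toNat else 0) := by
    split_ifs with h
    · convert hasSum_ite_eq l.toNat (F l.toNat) using 1
      funext d
      rw [Set.indicator_apply]
      by_cases hd : (d : ℤ) = l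
      · subst hd; simp
      · rw [if_neg (by simpa using hd), if_neg (by omega)]
    · convert (hasSum_zero : HasSum (fun _ : ℕ => (0 : V)) 0) using 1
      funext d
      rw [Set.indicator_of_notMem]
      simp only [Set.mem_ofPred_eq]
      omega
  have ht' : HasSum (t.indicator F) (∑' d : t, F d) := by
    rw [← hasSum_subtype_iff_indicator]
    exact (hF.subtype t).hasSum
  have := (hsum N hN0).unique (by rw [hsplit]; exact ht'.add hsing)
  rw [this, dist_eq_norm, add_sub_cancel_right]
  simpa using hs t hdisj

/-! ### Coefficient estimate for operator-valued power series -/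

/-- Bounded power series are contractive multipliers: the coefficients of orders `0` and `m` of
`w ↦ G(w) (x + w ^ m y)` satisfy Parseval's inequality. -/
theorem norm_sq_coeff_add_le {E : Type*} [NormedAddCommGroup E] [InnerProductSpace ℂ E]
    [CompleteSpace E] {F : ℕ → E →L[ℂ] E} (hF : Summable F) {G : ℂ → E →L[ℂ] E}
    (hG : ∀ w : ℂ, ‖w‖ = 1 → HasSum (fun d => w ^ d • F d) (G w)) {M : ℝ}
    (hGM : ∀ w : ℂ, ‖w‖ = 1 → ‖G w‖ ≤ M) {m : ℕ} (hm : m ≠ 0) (x y : E) :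
    ‖F 0 x‖ ^ 2 + ‖F m x + F 0 y‖ ^ 2 ≤ M ^ 2 * (‖x‖ ^ 2 + ‖y‖ ^ 2) := by
  have hA : ∀ l : ℤ, ∀ z : E, Tendsto (fun N => rootAverage G l N z) atTop
      (𝓝 ((if 0 ≤ l then F l.toNat else 0) z)) := fun l z =>
    ((ContinuousLinearMap.apply ℂ E z).continuous.tendsto _).comp (tendsto_rootAverage hF hG l)
  have h0 := (hA 0 x).add (hA (-m) y)
  have h1 := (hA m x).add (hA 0 y)
  have hneg : ¬ (0 : ℤ) ≤ -m := by omega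
  simp only [le_refl, if_true, hneg, if_false, Int.toNat_zero, zero_apply,
    add_zero, Nat.cast_nonneg, Int.toNat_natCast] at h0 h1
  refine le_of_tendsto ((h0.norm.pow 2).add (h1.norm.pow 2)) ?_
  filter_upwards [eventually_gt_atTop m] with N hN
  have hN0 : N ≠ 0 := by omega
  have hNr : (0 : ℝ) < N := by exact_mod_cast Nat.pos_of_ne_zero hN0
  set w : ℕ → ℂ := fun j => rootUnity N ^ j with hw
  have hw1 : ∀ j, ‖w j‖ = 1 := norm_rootUnity_pow N
  have hw0 : ∀ j, w j ≠ 0 := fun j => pow_ne_zero _ (rootUnity_ne_zero N)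
  have hndvd : ¬ (N : ℤ) ∣ m := fun h => by
    have := Int.le_of_dvd (by omega) h
    omega
  have hsum0 : ∑ j ∈ range N, w j ^ m = 0 := by
    have := sum_rootUnity_zpow hN0 m
    simpa only [zpow_natCast, hndvd, if_false] using this
  have hstar : ∀ j, star (w j ^ m) = w j ^ (-(m : ℤ)) := fun j => by
    have h1 : ‖w j ^ m‖ = 1 := by rw [norm_pow, hw1, one_pow]
    have h2 := Complex.inv_eq_conj h1
    rw [zpow_neg, zpow_natCast, h2]; rfl
  set g : ℕ → E := fun j => G (w j) (x + w j ^ m • y) with hg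
  have hu1 : ∀ j ∈ range N, ‖w j ^ m‖ = 1 := fun j _ => by rw [norm_pow, hw1, one_pow]
  have hB := norm_sq_sum_add_norm_sq_sum_le (range N) (fun j => w j ^ m) hu1 hsum0 g
  have hp : rootAverage G 0 N x + rootAverage G (-m) N y = (N : ℂ)⁻¹ • ∑ j ∈ range N, g j := by
    simp only [rootAverage, smul_apply, _root_.sum_apply, hg,
      map_add, map_smul, sum_add_distrib, smul_add, neg_neg, zpow_natCast, neg_zero, zpow_zero,
      one_smul, hw]
  have hq : rootAverage G m N x + rootAverage G 0 N y =
      (N : ℂ)⁻¹ • ∑ j ∈ range N, star (w j ^ m) • g j := by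
    have h2 : ∀ j, star (w j ^ m) * w j ^ m = 1 := fun j => by
      rw [hstar, zpow_neg, zpow_natCast, inv_mul_cancel₀ (pow_ne_zero _ (hw0 j))]
    simp only [rootAverage, smul_apply, _root_.sum_apply, hg, map_add, map_smul,
      sum_add_distrib, smul_add, neg_zero, zpow_zero, one_smul, smul_smul, h2]
    simp only [hstar]
    rfl
  have hgb : ∑ j ∈ range N, ‖g j‖ ^ 2 ≤ N * (M ^ 2 * (‖x‖ ^ 2 + ‖y‖ ^ 2)) := by
    have h1 : ∀ j ∈ range N, ‖g j‖ ^ 2 ≤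
        M ^ 2 * (‖x‖ ^ 2 + ‖y‖ ^ 2) + 2 * M ^ 2 * (w j ^ m * inner ℂ x y).re := by
      intro j _
      have h2 : ‖g j‖ ≤ M * ‖x + w j ^ m • y‖ :=
        (G (w j)).le_of_opNorm_le (hGM _ (hw1 j)) _
      calc ‖g j‖ ^ 2 ≤ (M * ‖x + w j ^ m • y‖) ^ 2 := by gcongr
        _ = M ^ 2 * ‖x + w j ^ m • y‖ ^ 2 := by ring
        _ = _ := by
          rw [norm_add_sq (𝕜 := ℂ), inner_smul_right, norm_smul, norm_pow, hw1, one_pow, one_mul]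
          change M ^ 2 * (‖x‖ ^ 2 + 2 * (w j ^ m * inner ℂ x y).re + ‖y‖ ^ 2) = _
          ring
    refine (sum_le_sum h1).trans (le_of_eq ?_)
    rw [sum_add_distrib, ← mul_sum, ← mul_sum, ← Complex.re_sum, ← sum_mul, hsum0]
    simp
    ring
  rw [hp, hq, norm_smul, norm_smul, norm_inv, Complex.norm_natCast]
  rw [card_range] at hB
  have h3 : (N : ℝ) * ∑ j ∈ range N, ‖g j‖ ^ 2 ≤ N * (N * (M ^ 2 * (‖x‖ ^ 2 + ‖y‖ ^ 2))) := by
    gcongr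
  rw [mul_pow, mul_pow, ← mul_add, inv_pow, inv_mul_le_iff₀ (by positivity)]
  nlinarith [hB.trans h3]

/-- If the constant coefficient is the scalar `a`, the remaining coefficients of a power series
bounded by `M` have norm at most `(M ^ 2 - |a| ^ 2) / M`. -/
theorem mul_norm_coeff_le {E : Type*} [NormedAddCommGroup E] [InnerProductSpace ℂ E]
    [CompleteSpace E] {F : ℕ → E →L[ℂ] E} (hF : Summable F) {G : ℂ → E →L[ℂ] E}
    (hG : ∀ w : ℂ, ‖w‖ = 1 → HasSum (fun d => w ^ d • F d) (G w)) {M : ℝ} (hM : 0 ≤ M)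
    (hGM : ∀ w : ℂ, ‖w‖ = 1 → ‖G w‖ ≤ M) {a : ℂ} (ha : F 0 = a • 1) (haM : ‖a‖ ≤ M)
    {m : ℕ} (hm : m ≠ 0) : M * ‖F m‖ ≤ M ^ 2 - ‖a‖ ^ 2 := by
  have hd : 0 ≤ M ^ 2 - ‖a‖ ^ 2 := by nlinarith [norm_nonneg a]
  -- Parseval's inequality at `y = s ā F_m x`.
  have hineq : ∀ (s : ℝ) (x : E), ‖a‖ ^ 2 * ‖x‖ ^ 2 + (1 + ‖a‖ ^ 2 * s) ^ 2 * ‖F m x‖ ^ 2 ≤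
      M ^ 2 * (‖x‖ ^ 2 + ‖a‖ ^ 2 * s ^ 2 * ‖F m x‖ ^ 2) := by
    intro s x
    have h := norm_sq_coeff_add_le hF hG hGM hm x ((star a * s) • F m x)
    have h1 : F m x + F 0 ((star a * s) • F m x) = ((1 + ‖a‖ ^ 2 * s : ℝ) : ℂ) • F m x := by
      have : a * (star a * s) = ((‖a‖ ^ 2 * s : ℝ) : ℂ) := by
        rw [← mul_assoc]
        have := Complex.mul_conj' a
        rw [show star a = (starRingEnd ℂ) a from rfl, this]; push_cast; ring
      rw [ha, smul_apply, one_apply_eq_self, smul_smul, this,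
        Complex.ofReal_add, add_smul, Complex.ofReal_one, one_smul]
    rw [h1, ha, smul_apply, one_apply_eq_self, norm_smul,
      norm_smul, norm_smul, Complex.norm_real, norm_mul, norm_star, Complex.norm_real, mul_pow,
      mul_pow, mul_pow, mul_pow, Real.norm_eq_abs, Real.norm_eq_abs, sq_abs, sq_abs] at h
    linarith
  rcases hM.eq_or_lt with rfl | hMpos
  · simpa using hd
  rw [mul_comm, ← le_div_iff₀ hMpos]
  refine ContinuousLinearMap.opNorm_le_bound _ (by positivity) fun x => ?_
  rw [div_mul_eq_mul_div, le_div_iff₀ hMpos]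
  refine le_of_sq_le_sq ?_ (by positivity)
  rcases hd.eq_or_lt with h | h
  · have := hineq 0 x
    have hc : ‖a‖ ^ 2 = M ^ 2 := by linarith
    have h2 : ‖F m x‖ ^ 2 ≤ 0 := by rw [hc] at this; linarith
    have h3 : ‖F m x‖ = 0 := pow_eq_zero_iff two_ne_zero |>.1 (le_antisymm h2 (sq_nonneg _))
    rw [← h, h3]
    simp
  · -- `s = 1 / (M ^ 2 - |a| ^ 2)` is the optimal choice in the quadratic inequality.
    have := hineq (1 / (M ^ 2 - ‖a‖ ^ 2)) x
    set D := M ^ 2 - ‖a‖ ^ 2 with hD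
    have hc : ‖a‖ ^ 2 = M ^ 2 - D := by rw [hD]; ring
    rw [hc] at this
    have e : (1 + (M ^ 2 - D) * (1 / D)) ^ 2 * ‖F m x‖ ^ 2
        - M ^ 2 * ((M ^ 2 - D) * (1 / D) ^ 2 * ‖F m x‖ ^ 2) = M ^ 2 * ‖F m x‖ ^ 2 / D := by
      field_simp; ring
    have h2 : M ^ 2 * ‖F m x‖ ^ 2 / D ≤ D * ‖x‖ ^ 2 := by rw [← e]; linarith
    rw [div_le_iff₀ h] at h2
    nlinarith

/-- Bohr's summation: coefficients obeying the Schwarz–Pick bound sum at radius `1 / 3` to at most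
`c + (M ^ 2 - c ^ 2) / (2 M)`. -/
theorem tsum_enorm_third_pow_smul_le {V : Type*} [NormedAddCommGroup V] [NormedSpace ℂ V]
    {F : ℕ → V} {c M : ℝ} (hM : 0 < M) (hcM : c ≤ M) (h0 : ‖F 0‖ ≤ c)
    (h : ∀ m, m ≠ 0 → M * ‖F m‖ ≤ M ^ 2 - c ^ 2) :
    ∑' m : ℕ, ‖(1 / 3 : ℂ) ^ m • F m‖ₑ ≤ ENNReal.ofReal (c + (M ^ 2 - c ^ 2) / (2 * M)) := by
  have hc : 0 ≤ c := (norm_nonneg _).trans h0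
  have hD : 0 ≤ (M ^ 2 - c ^ 2) / M := by
    have : 0 ≤ M ^ 2 - c ^ 2 := by nlinarith
    positivity
  set D := (M ^ 2 - c ^ 2) / M with hDdef
  have hb : ∀ m, ‖(1 / 3 : ℂ) ^ (m + 1) • F (m + 1)‖ₑ ≤
      ENNReal.ofReal (D * (1 / 3) * (1 / 3) ^ m) := by
    intro m
    rw [← ofReal_norm]
    refine ENNReal.ofReal_le_ofReal ?_
    rw [norm_smul, norm_pow]
    have h1 : ‖(1 / 3 : ℂ)‖ = 1 / 3 := by norm_num
    have h2 : ‖F (m + 1)‖ ≤ D := by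
      rw [hDdef, le_div_iff₀ hM, mul_comm]; exact h _ (Nat.succ_ne_zero m)
    rw [h1, pow_succ]
    nlinarith [mul_le_mul_of_nonneg_left h2 (by positivity : (0 : ℝ) ≤ (1 / 3) ^ m * (1 / 3))]
  rw [tsum_eq_zero_add' ENNReal.summable, ENNReal.ofReal_add hc (by
    rw [mul_comm, ← div_div]; positivity)]
  refine add_le_add ?_ ?_
  · rw [pow_zero, one_smul, ← ofReal_norm]
    exact ENNReal.ofReal_le_ofReal h0
  · refine (ENNReal.tsum_le_tsum hb).trans (le_of_eq ?_)
    have hg : HasSum (fun m : ℕ => D * (1 / 3) * (1 / 3 : ℝ) ^ m) (D * (1 / 3) * (1 - 1 / 3)⁻¹) :=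
      (hasSum_geometric_of_lt_one (by norm_num) (by norm_num)).mul_left _
    rw [← ENNReal.ofReal_tsum_of_nonneg (fun m => by positivity) hg.summable, hg.tsum_eq]
    congr 1
    rw [hDdef]; field_simp; norm_num

/-! ### Homogeneous expansions on the polyball -/

section Expansions

variable {k : ℕ} {n : Fin k → ℕ}

theorem mem_Gam {m : ℕ} {α : Words n} : α ∈ Gam n m ↔ ∑ i, (α i).length = m := by
  simp [Gam, degreeSet]

theorem mem_Lam {p : Fin k → ℕ} {α : Words n} : α ∈ Lam n p ↔ ∀ i, (α i).length = p i := by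
  simp [Lam, multiDegreeSet]

theorem sum_Gam_eq_sum_piAntidiag {V : Type*} [AddCommMonoid V] (f : Words n → V) (m : ℕ) :
    ∑ α ∈ Gam n m, f α = ∑ p ∈ piAntidiag univ m, ∑ α ∈ Lam n p, f α := by
  rw [← sum_fiberwise_of_maps_to (s := Gam n m) (t := piAntidiag univ m)
    (g := fun α i => (α i).length) (fun α hα => by simpa using mem_Gam.1 hα)]
  refine sum_congr rfl fun p hp => sum_congr ?_ fun _ _ => rfl
  ext α
  rw [mem_filter, mem_Gam, mem_Lam, funext_iff]
  refine ⟨fun h => h.2, fun h => ⟨?_, h⟩⟩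
  rw [sum_congr rfl fun i _ => h i]
  simpa using hp

/-- An unconditionally convergent multi-homogeneous expansion may be summed by total degree. -/
theorem hasSum_piAntidiag {V : Type*} [NormedAddCommGroup V] {f : (Fin k → ℕ) → V}
    (hf : Summable f) : HasSum (fun m => ∑ p ∈ piAntidiag univ m, f p) (∑' p, f p) := by
  have h := (Equiv.sigmaFiberEquiv fun p : Fin k → ℕ => ∑ i, p i).hasSum_iff.2 hf.hasSum
  refine h.sigma fun m => ?_
  have h2 := Finset.hasSum (piAntidiag (univ : Finset (Fin k)) m) f
  let e : {p : Fin k → ℕ // ∑ i, p i = m} ≃ (piAntidiag (univ : Finset (Fin k)) m) :=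
    Equiv.subtypeEquivRight fun p => by simp
  exact e.hasSum_iff.2 h2

theorem prod_ofFn_smul {R : Type*} [Ring R] [Algebra ℂ R] {l : ℕ} (c : Fin l → ℂ)
    (T : Fin l → R) :
    (List.ofFn fun i => c i • T i).prod = (∏ i, c i) • (List.ofFn T).prod := by
  induction l with
  | zero => simp
  | succ l ih =>
    rw [List.ofFn_succ, List.ofFn_succ, List.prod_cons, List.prod_cons, ih, Fin.prod_univ_succ,
      smul_mul_smul_comm]

theorem prod_ofFn_eq_of_forall_ne {R : Type*} [Monoid R] {l : ℕ} (T : Fin l → R) (i : Fin l)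
    (h : ∀ j, j ≠ i → T j = 1) : (List.ofFn T).prod = T i := by
  induction l with
  | zero => exact i.elim0
  | succ l ih =>
    rw [List.ofFn_succ, List.prod_cons]
    refine Fin.cases (fun h => ?_) (fun i h => ?_) i h
    · have : (fun j : Fin l => T j.succ) = fun _ => 1 :=
        funext fun j => h _ (Fin.succ_ne_zero j)
      rw [this]; simp
    · rw [h 0 (Fin.succ_ne_zero i).symm, one_mul]
      exact ih (fun j => T j.succ) i fun j hj => h _ fun h' => hj (Fin.succ_injective _ h')

variable {H : Type u} [NormedAddCommGroup H] [InnerProductSpace ℂ H]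

theorem lift_smul_apply {m : ℕ} (c : ℂ) (T : Fin m → (H →L[ℂ] H)) (w : FreeMonoid (Fin m)) :
    FreeMonoid.lift (c • T) w = c ^ w.length • FreeMonoid.lift T w := by
  induction w using FreeMonoid.inductionOn' with
  | one => simp
  | of_mul j w ih =>
    rw [map_mul, map_mul, ih, FreeMonoid.length_mul, FreeMonoid.length_of, FreeMonoid.lift_eval_of,
      FreeMonoid.lift_eval_of, Pi.smul_apply, smul_mul_smul_comm, pow_add, pow_one]

theorem monomial_smul (c : ℂ) (X : Tuple n H) (α : Words n) :
    monomial (c • X) α = c ^ (∑ i, (α i).length) • monomial X α := by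
  simp only [monomial, Pi.smul_apply, lift_smul_apply]
  rw [prod_ofFn_smul, prod_pow_eq_pow_sum]

theorem monomial_one (X : Tuple n H) : monomial X (1 : Words n) = 1 := by
  simp [monomial]

theorem Gam_zero : Gam n 0 = {1} := by
  ext α
  rw [mem_Gam, mem_singleton, sum_eq_zero_iff, funext_iff]
  simp [FreeMonoid.length_eq_zero]

theorem monomial_zero {α : Words n} (h : ∑ i, (α i).length ≠ 0) :
    monomial (0 : Tuple n H) α = 0 := by
  have := monomial_smul 0 (0 : Tuple n H) α
  rwa [zero_pow h, zero_smul, zero_smul] at this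

theorem continuous_monomial (α : Words n) : Continuous fun X : Tuple n H => monomial X α := by
  simp only [monomial, List.ofFn_eq_map]
  refine continuous_list_prod _ fun i _ => ?_
  simp only [FreeMonoid.lift_apply]
  refine continuous_list_prod _ fun j _ => ?_
  fun_prop

variable [CompleteSpace H]

theorem Phi_zero {m : ℕ} : Phi (0 : Fin m → (H →L[ℂ] H)) = 0 := by
  ext1 Y
  simp [Phi]

theorem Phi_smul {m : ℕ} {w : ℂ} (hw : ‖w‖ = 1) (T : Fin m → (H →L[ℂ] H)) :
    Phi (w • T) = Phi T := by
  ext1 Y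
  have : w * star w = 1 := by
    rw [Complex.star_def, Complex.mul_conj', hw]; simp
  rw [Complex.star_def, mul_comm] at this
  simp [Phi, smul_smul, this]

/-- Circular symmetry: rotations fix the maps `Φ_{X_i}`, hence the defect. -/
theorem smul_mem_polyball {w : ℂ} (hw : ‖w‖ = 1) {X : Tuple n H} (hX : X ∈ polyball n H) :
    w • X ∈ polyball n H := by
  obtain ⟨h1, h2, h3⟩ := hX
  have hD : Defect (w • X) = Defect X := by
    simp only [Defect, Pi.smul_apply, Phi_smul hw]
  refine ⟨fun s t hst i j => ?_, fun i => ?_, by rwa [hD]⟩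
  · simp only [Pi.smul_apply, smul_mul_smul_comm, h1 s t hst i j]
  · have : ∑ j, (w • X) i j * star ((w • X) i j) = ∑ j, X i j * star (X i j) := by
      have h := congrArg (fun Φ => Φ (1 : H →L[ℂ] H)) (Phi_smul hw (X i))
      simpa [Phi] using h
    rw [this]; exact h2 i

theorem zero_mem_polyball : (0 : Tuple n H) ∈ polyball n H := by
  have hD : Defect (0 : Tuple n H) = 1 := by
    have h1 : (LinearMap.id - (0 : Module.End ℂ (H →L[ℂ] H))) = 1 := by rw [sub_zero]; rfl
    simp [Defect, Phi_zero, h1]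
  refine ⟨by simp, by simp, ?_⟩
  rw [hD]
  exact ⟨ContinuousLinearMap.isPositive_one, isUnit_one⟩

end Expansions

/-! ### The Bohr inequality -/

section Bohr

variable {k : ℕ} {n : Fin k → ℕ} {H : Type u} [NormedAddCommGroup H] [InnerProductSpace ℂ H]
  {E : Type*} [NormedAddCommGroup E] [InnerProductSpace ℂ E]

/-- The degree `m` part `∑_{α ∈ Γ_m} L_α(X_α)` of a series whose terms depend linearly on the
monomials. Operator coefficients give `L_α = A_α ⊗ ·`, scalar ones `L_α = a_α • ·`. -/
noncomputable def degreePart (L : Words n → (H →L[ℂ] H) →ₗ[ℂ] (E →L[ℂ] E)) (X : Tuple n H)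
    (m : ℕ) : E →L[ℂ] E :=
  ∑ α ∈ Gam n m, L α (monomial X α)

/-- The part of multidegree `p`, `∑_{α ∈ Λ_p} L_α(X_α)`, of a series whose terms depend linearly on
the monomials. -/
noncomputable def multidegreePart (L : Words n → (H →L[ℂ] H) →ₗ[ℂ] (E →L[ℂ] E))
    (X : Tuple n H) (p : Fin k → ℕ) : E →L[ℂ] E :=
  ∑ α ∈ Lam n p, L α (monomial X α)

variable (L : Words n → (H →L[ℂ] H) →ₗ[ℂ] (E →L[ℂ] E)) (X : Tuple n H)

theorem degreePart_smul (c : ℂ) (m : ℕ) : degreePart L (c • X) m = c ^ m • degreePart L X m := by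
  rw [degreePart, degreePart, smul_sum]
  refine sum_congr rfl fun α hα => ?_
  rw [monomial_smul, mem_Gam.1 hα, map_smul]

theorem degreePart_zero : degreePart L X 0 = L 1 1 := by
  rw [degreePart, Gam_zero, sum_singleton, monomial_one]

theorem degreePart_eq_sum (m : ℕ) :
    degreePart L X m = ∑ p ∈ piAntidiag univ m, multidegreePart L X p :=
  sum_Gam_eq_sum_piAntidiag _ m

theorem tsum_multidegreePart_zero :
    ∑' p, multidegreePart L (0 : Tuple n H) p = L 1 1 := by
  rw [tsum_eq_single 0]
  · rw [← degreePart_zero L 0, degreePart_eq_sum, piAntidiag_zero, sum_singleton]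
  · intro p hp
    refine sum_eq_zero fun α hα => ?_
    rw [monomial_zero, map_zero]
    intro h0
    refine hp (funext fun i => ?_)
    rw [← mem_Lam.1 hα i]
    exact sum_eq_zero_iff.1 h0 i (mem_univ i)

variable {L X}

theorem hasSum_degreePart (hs : Summable (multidegreePart L X)) :
    HasSum (degreePart L X) (∑' p, multidegreePart L X p) := by
  simpa only [← degreePart_eq_sum] using hasSum_piAntidiag hs

theorem hasSum_smul_degreePart {w : ℂ} (hs : Summable (multidegreePart L (w • X))) :
    HasSum (fun m => w ^ m • degreePart L X m) (∑' p, multidegreePart L (w • X) p) := by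
  simpa only [← degreePart_smul] using hasSum_degreePart hs

/-- This and the next two lemmas are stated for a plain inner product space `E`: on `HTensor K H`
the required norm instances agree only up to unfolding, so they are supplied by unification. -/
theorem norm_le_toReal_of_enorm_le {T : E →L[ℂ] E} {S : ℝ≥0∞} (hS : S < ∞) (h : ‖T‖ₑ ≤ S) :
    ‖T‖ ≤ S.toReal := by
  rw [← toReal_enorm]
  exact ENNReal.toReal_mono hS.ne h

theorem enorm_le_zero_of_eq_zero {T : E →L[ℂ] E} (hT : T = 0) : ‖T‖ₑ ≤ 0 := by
  rw [← ofReal_norm, hT, norm_zero, ENNReal.ofReal_zero]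

theorem norm_smul_one_of_ne_zero {T : E →L[ℂ] E} (hT : T ≠ 0) (a : ℂ) :
    ‖a • (1 : E →L[ℂ] E)‖ = ‖a‖ := by
  have : Nontrivial E := by
    obtain ⟨x, hx⟩ := DFunLike.ne_iff.1 hT
    exact ⟨⟨_, _, hx⟩⟩
  rw [norm_smul, norm_one, mul_one]

variable [CompleteSpace E]

/-- A series vanishing on the circle `{w X : |w| = 1}` has zero homogeneous parts at `X`. -/
theorem degreePart_eq_zero (hs : ∀ w : ℂ, ‖w‖ = 1 → Summable (multidegreePart L (w • X)))
    (h0 : ∀ w : ℂ, ‖w‖ = 1 → ∑' p, multidegreePart L (w • X) p = 0) (m : ℕ) :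
    degreePart L X m = 0 := by
  have hs1 : Summable (degreePart L X) := by
    have := hs 1 norm_one
    rw [one_smul] at this
    exact (hasSum_degreePart this).summable
  have h := tendsto_rootAverage hs1 (G := fun _ => 0)
    (fun w hw => by rw [← h0 w hw]; exact hasSum_smul_degreePart (hs w hw)) m
  have h' : rootAverage (fun _ => (0 : E →L[ℂ] E)) (m : ℤ) = fun _ => 0 := by
    funext N; simp [rootAverage]
  rw [h'] at h
  simpa using tendsto_nhds_unique h tendsto_const_nhds

theorem mul_norm_degreePart_le
    (hs : ∀ w : ℂ, ‖w‖ = 1 → Summable (multidegreePart L (w • X))) {M : ℝ} (hM : 0 ≤ M)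
    (hb : ∀ w : ℂ, ‖w‖ = 1 → ‖∑' p, multidegreePart L (w • X) p‖ ≤ M) {a : ℂ}
    (ha : L 1 1 = a • 1) (haM : ‖a‖ ≤ M) {m : ℕ} (hm : m ≠ 0) :
    M * ‖degreePart L X m‖ ≤ M ^ 2 - ‖a‖ ^ 2 := by
  have hs1 : Summable (degreePart L X) := by
    have := hs 1 norm_one
    rw [one_smul] at this
    exact (hasSum_degreePart this).summable
  exact mul_norm_coeff_le hs1 (fun w hw => hasSum_smul_degreePart (hs w hw)) hM hb
    ((degreePart_zero L X).trans ha) haM hm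

theorem bohr_bound_le {c M : ℝ} (hM : 0 < M) (h : c ≤ M) : c + (M ^ 2 - c ^ 2) / (2 * M) ≤ M := by
  rw [← le_sub_iff_add_le', div_le_iff₀ (by positivity)]
  nlinarith

theorem bohr_bound_lt {c M : ℝ} (hM : 0 < M) (h : c < M) : c + (M ^ 2 - c ^ 2) / (2 * M) < M := by
  rw [← lt_sub_iff_add_lt', div_lt_iff₀ (by positivity)]
  nlinarith

theorem tsum_enorm_degreePart_third_le_bound
    (hs : ∀ w : ℂ, ‖w‖ = 1 → Summable (multidegreePart L (w • X))) {M : ℝ} (hM : 0 < M)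
    (hb : ∀ w : ℂ, ‖w‖ = 1 → ‖∑' p, multidegreePart L (w • X) p‖ ≤ M) {a : ℂ}
    (ha : L 1 1 = a • 1) (haM : ‖a‖ ≤ M) :
    ∑' m, ‖degreePart L ((1 / 3 : ℂ) • X) m‖ₑ ≤
      ENNReal.ofReal (‖a‖ + (M ^ 2 - ‖a‖ ^ 2) / (2 * M)) := by
  simp only [degreePart_smul]
  refine tsum_enorm_third_pow_smul_le hM haM ?_
    fun m hm => mul_norm_degreePart_le hs hM.le hb ha haM hm
  rw [degreePart_zero, ha, norm_smul]
  exact mul_le_of_le_one_right (norm_nonneg a) ContinuousLinearMap.norm_id_le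

/-- If the constant term attains the bound, the series is constant. -/
theorem tsum_multidegreePart_eq
    (hs : ∀ w : ℂ, ‖w‖ = 1 → Summable (multidegreePart L (w • X))) {M : ℝ} (hM : 0 < M)
    (hb : ∀ w : ℂ, ‖w‖ = 1 → ‖∑' p, multidegreePart L (w • X) p‖ ≤ M) {a : ℂ}
    (ha : L 1 1 = a • 1) (haM : ‖a‖ = M) : ∑' p, multidegreePart L X p = L 1 1 := by
  have hs1 : Summable (multidegreePart L X) := by simpa using hs 1 norm_one
  refine (hasSum_degreePart hs1).unique ?_
  rw [← degreePart_zero L X]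
  refine hasSum_single 0 fun m hm => ?_
  have h := mul_norm_degreePart_le hs hM.le hb ha haM.le hm
  rw [haM, sub_self] at h
  exact norm_le_zero_iff.1 (nonpos_of_mul_nonpos_right h hM)


/-- A series bounded by `M` on the circle `{w X : |w| = 1}`, with scalar constant term `a`, obeys
Bohr's inequality at `X / 3`. For `M = 0` nothing is asked of `a`, which is undetermined when `E`
is trivial. -/
theorem tsum_enorm_degreePart_third_le
    (hs : ∀ w : ℂ, ‖w‖ = 1 → Summable (multidegreePart L (w • X))) {M : ℝ} (hM : 0 ≤ M)
    (hb : ∀ w : ℂ, ‖w‖ = 1 → ‖∑' p, multidegreePart L (w • X) p‖ ≤ M) {a : ℂ}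
    (ha : L 1 1 = a • 1) (haM : 0 < M → ‖a‖ ≤ M) :
    ∑' m, ‖degreePart L ((1 / 3 : ℂ) • X) m‖ₑ ≤ ENNReal.ofReal M := by
  rcases hM.eq_or_lt with rfl | hM
  · have hz : ∀ m, ‖degreePart L ((1 / 3 : ℂ) • X) m‖ₑ = 0 := fun m => by
      rw [degreePart_smul,
        degreePart_eq_zero hs (fun w hw => norm_le_zero_iff.1 (hb w hw)) m, smul_zero, enorm_zero]
    simp only [hz, tsum_zero, zero_le]
  · exact (tsum_enorm_degreePart_third_le_bound hs hM hb ha (haM hM)).trans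
      (ENNReal.ofReal_le_ofReal (bohr_bound_le hM (haM hM)))

theorem tsum_enorm_degreePart_third_lt
    (hs : ∀ w : ℂ, ‖w‖ = 1 → Summable (multidegreePart L (w • X))) {M : ℝ}
    (hb : ∀ w : ℂ, ‖w‖ = 1 → ‖∑' p, multidegreePart L (w • X) p‖ ≤ M) {a : ℂ}
    (ha : L 1 1 = a • 1) (haM : ‖a‖ < M) :
    ∑' m, ‖degreePart L ((1 / 3 : ℂ) • X) m‖ₑ < ENNReal.ofReal M := by
  have hM : 0 < M := (norm_nonneg a).trans_lt haM
  exact (tsum_enorm_degreePart_third_le_bound hs hM hb ha haM.le).trans_lt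
    ((ENNReal.ofReal_lt_ofReal_iff hM).2 (bohr_bound_lt hM haM))

end Bohr

/-! ### Operators on the Hilbert tensor product -/

section OpTensor

theorem completion_clm_ext {V W : Type*} [NormedAddCommGroup V] [NormedSpace ℂ V]
    [NormedAddCommGroup W] [NormedSpace ℂ W]
    {f g : UniformSpace.Completion V →L[ℂ] W}
    (h : ∀ x : V, f x = g x) : f = g :=
  DFunLike.coe_injective (UniformSpace.Completion.ext f.continuous g.continuous h)

variable {K : Type v} [NormedAddCommGroup K] [InnerProductSpace ℂ K]
  {H : Type u} [NormedAddCommGroup H] [InnerProductSpace ℂ H]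

theorem opTensor_coe (A : K →L[ℂ] K) (T : H →L[ℂ] H) (x : K ⊗[ℂ] H) :
    opTensor A T (x : HTensor K H) = (TensorProduct.mapL A T x : K ⊗[ℂ] H) :=
  ContinuousLinearMap.completion_apply_coe _ _

theorem opTensor_add (A : K →L[ℂ] K) (S T : H →L[ℂ] H) :
    opTensor A (S + T) = opTensor A S + opTensor A T :=
  completion_clm_ext fun x => by
    rw [add_apply, opTensor_coe, opTensor_coe, opTensor_coe, TensorProduct.mapL_add_right,
      add_apply, UniformSpace.Completion.coe_add]

theorem opTensor_smul (A : K →L[ℂ] K) (c : ℂ) (T : H →L[ℂ] H) :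
    opTensor A (c • T) = c • opTensor A T :=
  completion_clm_ext fun x => by
    rw [smul_apply, opTensor_coe, opTensor_coe, TensorProduct.mapL_smul_right,
      smul_apply, UniformSpace.Completion.coe_smul]

theorem smul_opTensor (A : K →L[ℂ] K) (c : ℂ) (T : H →L[ℂ] H) :
    opTensor (c • A) T = c • opTensor A T :=
  completion_clm_ext fun x => by
    rw [smul_apply, opTensor_coe, opTensor_coe, TensorProduct.mapL_smul_left,
      smul_apply, UniformSpace.Completion.coe_smul]

theorem opTensor_one_one : opTensor (1 : K →L[ℂ] K) (1 : H →L[ℂ] H) = 1 :=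
  completion_clm_ext fun x => by
    rw [opTensor_coe]
    exact congrArg (fun f : K ⊗[ℂ] H →L[ℂ] K ⊗[ℂ] H => ((f x : K ⊗[ℂ] H) : HTensor K H))
      TensorProduct.mapL_id_id

theorem norm_opTensor_le (A : K →L[ℂ] K) (T : H →L[ℂ] H) : ‖opTensor A T‖ ≤ ‖A‖ * ‖T‖ := by
  refine ContinuousLinearMap.opNorm_le_bound _ (by positivity) fun x => ?_
  induction x using UniformSpace.Completion.induction_on with
  | hp => exact isClosed_le (by fun_prop) (by fun_prop)
  | ih x =>
    rw [opTensor_coe, UniformSpace.Completion.norm_coe, UniformSpace.Completion.norm_coe]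
    exact ContinuousLinearMap.le_of_opNorm_le _ (TensorProduct.norm_mapL_le A T) x

/-- `T ↦ A ⊗ T` as a linear map. -/
noncomputable def opTensorLin (A : K →L[ℂ] K) :
    (H →L[ℂ] H) →ₗ[ℂ] (HTensor K H →L[ℂ] HTensor K H) where
  toFun := opTensor A
  map_add' := opTensor_add A
  map_smul' := fun c T => opTensor_smul A c T

theorem continuous_opTensor (A : K →L[ℂ] K) : Continuous fun T : H →L[ℂ] H => opTensor A T :=
  AddMonoidHomClass.continuous_of_bound (opTensorLin A).toAddMonoidHom ‖A‖ (norm_opTensor_le A)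

theorem nontrivial_hTensor [Nontrivial K] [Nontrivial H] : Nontrivial (HTensor K H) := by
  obtain ⟨x, hx⟩ := exists_ne (0 : K)
  obtain ⟨y, hy⟩ := exists_ne (0 : H)
  refine ⟨⟨((x ⊗ₜ[ℂ] y : K ⊗[ℂ] H) : HTensor K H), 0, fun h => ?_⟩⟩
  have := congrArg norm h
  rw [UniformSpace.Completion.norm_coe, TensorProduct.norm_tmul, norm_zero] at this
  simp_all

end OpTensor

/-! ### Bohr's inequality for bounded free holomorphic functions -/

section OperatorBohr

variable {k : ℕ} {n : Fin k → ℕ} {K : Type v} [NormedAddCommGroup K] [InnerProductSpace ℂ K]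
  {H : Type u} [NormedAddCommGroup H] [InnerProductSpace ℂ H] [CompleteSpace H]

theorem enorm_value_le_supNorm (A : Words n → (K →L[ℂ] K)) {X : Tuple n H}
    (hX : X ∈ polyball n H) : ‖value A X‖ₑ ≤ supNorm.{u, v} A :=
  le_iSup_of_le H <| le_iSup_of_le _ <| le_iSup_of_le _ <| le_iSup_of_le _ <|
    le_iSup_of_le X <| le_iSup_of_le hX le_rfl

theorem norm_value_le {A : Words n → (K →L[ℂ] K)} (hA : supNorm.{u, v} A < ∞) {X : Tuple n H}
    (hX : X ∈ polyball n H) : ‖value A X‖ ≤ (supNorm.{u, v} A).toReal :=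
  norm_le_toReal_of_enorm_le hA (enorm_value_le_supNorm A hX)

theorem supNorm_le {A : Words n → (K →L[ℂ] K)} {S : ℝ≥0∞}
    (h : ∀ (H : Type u) [NormedAddCommGroup H] [InnerProductSpace ℂ H] [CompleteSpace H],
      ∀ X ∈ polyball n H, ‖value A X‖ₑ ≤ S) : supNorm.{u, v} A ≤ S :=
  iSup_le fun H => iSup_le fun _ => iSup_le fun _ => iSup_le fun _ => iSup_le fun X =>
    iSup_le fun hX => h H X hX

theorem norm_le_of_value_zero {A : Words n → (K →L[ℂ] K)} (hA : supNorm.{u, v} A < ∞)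
    (hA0 : supNorm.{u, v} A ≠ 0) {a : ℂ}
    (ha : ∀ (H : Type u) [NormedAddCommGroup H] [InnerProductSpace ℂ H] [CompleteSpace H],
      value A (0 : Tuple n H) = a • (1 : HTensor K H →L[ℂ] HTensor K H)) :
    ‖a‖ ≤ (supNorm.{u, v} A).toReal := by
  by_contra hlt
  refine hA0 (le_antisymm (supNorm_le fun H _ _ _ X _ => ?_) bot_le)
  -- A nonzero value lives on a nontrivial space, where `‖a I‖ = |a|`.
  have h0 : value A X = 0 := by
    by_contra hne
    refine hlt ?_
    have h := norm_value_le hA (zero_mem_polyball (n := n) (H := H))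
    rw [ha] at h
    exact (norm_smul_one_of_ne_zero hne a).symm.le.trans h
  exact enorm_le_zero_of_eq_zero h0

theorem bohr_operator {A : Words n → (K →L[ℂ] K)} (hA : IsBoundedFreeHolomorphic.{u, v} A)
    (hA0 : IsScalarAtZero.{u, v} A) {X : Tuple n H} (hX : X ∈ (1 / 3 : ℂ) • polyball n H) :
    ∑' m : ℕ, ‖homPart A X m‖ₑ ≤ supNorm.{u, v} A ∧
      (¬ IsConstant.{u, v} A → ∑' m : ℕ, ‖homPart A X m‖ₑ < supNorm.{u, v} A) := by
  obtain ⟨Y, hY, rfl⟩ := Set.mem_smul_set.1 hX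
  obtain ⟨a, ha⟩ := hA0
  obtain ⟨hhol, hfin⟩ := hA
  have hM := ENNReal.ofReal_toReal hfin.ne
  set M := (supNorm.{u, v} A).toReal with hMdef
  have hM0 : 0 ≤ M := ENNReal.toReal_nonneg
  have hs : ∀ (H : Type u) [NormedAddCommGroup H] [InnerProductSpace ℂ H] [CompleteSpace H],
      ∀ X ∈ polyball n H, ∀ w : ℂ, ‖w‖ = 1 →
        Summable (multidegreePart (fun α => opTensorLin (A α)) (w • X)) :=
    fun H _ _ _ X hX w hw => hhol H _ (smul_mem_polyball hw hX)
  have hb : ∀ (H : Type u) [NormedAddCommGroup H] [InnerProductSpace ℂ H] [CompleteSpace H],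
      ∀ X ∈ polyball n H, ∀ w : ℂ, ‖w‖ = 1 →
        ‖∑' p, multidegreePart (fun α => opTensorLin (A α)) (w • X) p‖ ≤ M :=
    fun H _ _ _ X hX w hw => norm_value_le hfin (smul_mem_polyball hw hX)
  have h1 : ∀ (H : Type u) [NormedAddCommGroup H] [InnerProductSpace ℂ H] [CompleteSpace H],
      opTensorLin (A 1) (1 : H →L[ℂ] H) = a • 1 := fun H _ _ _ =>
    (tsum_multidegreePart_zero fun α => opTensorLin (A α)).symm.trans (ha H)
  have haM : 0 < M → ‖a‖ ≤ M := fun h =>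
    norm_le_of_value_zero hfin (fun h0 => by rw [hMdef, h0] at h; simp at h) ha
  rw [← hM]
  refine ⟨tsum_enorm_degreePart_third_le (hs H Y hY) hM0 (hb H Y hY) (h1 H) haM, fun hc => ?_⟩
  refine tsum_enorm_degreePart_third_lt (hs H Y hY) (hb H Y hY) (h1 H) ?_
  have hMpos : 0 < M := hM0.lt_of_ne fun h0 => hc ⟨0, fun H _ _ _ X hX => by
    have hv : value A X = 0 :=
      norm_le_zero_iff (E := HTensor K H →L[ℂ] HTensor K H).1
        ((norm_value_le hfin hX).trans h0.ge)
    have hz := smul_opTensor (0 : K →L[ℂ] K) 0 (1 : H →L[ℂ] H)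
    rw [zero_smul, zero_smul] at hz
    rw [hv, hz]⟩
  exact (haM hMpos).lt_of_ne fun h => hc ⟨A 1, fun H _ _ _ X hX =>
    tsum_multidegreePart_eq (hs H X hX) hMpos (hb H X hX) (h1 H) h⟩

end OperatorBohr

namespace Scalar

variable {k : ℕ} {n : Fin k → ℕ} {H : Type u} [NormedAddCommGroup H] [InnerProductSpace ℂ H]
  [CompleteSpace H]

theorem enorm_value_le_supNorm (a : Words n → ℂ) {X : Tuple n H}
    (hX : X ∈ polyball n H) : ‖value a X‖ₑ ≤ supNorm.{u} a :=
  le_iSup_of_le H <| le_iSup_of_le _ <| le_iSup_of_le _ <| le_iSup_of_le _ <|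
    le_iSup_of_le X <| le_iSup_of_le hX le_rfl

theorem norm_value_le {a : Words n → ℂ} (ha : supNorm.{u} a < ∞) {X : Tuple n H}
    (hX : X ∈ polyball n H) : ‖value a X‖ ≤ (supNorm.{u} a).toReal :=
  norm_le_toReal_of_enorm_le ha (enorm_value_le_supNorm a hX)

theorem supNorm_le {a : Words n → ℂ} {S : ℝ≥0∞}
    (h : ∀ (H : Type u) [NormedAddCommGroup H] [InnerProductSpace ℂ H] [CompleteSpace H],
      ∀ X ∈ polyball n H, ‖value a X‖ₑ ≤ S) : supNorm.{u} a ≤ S :=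
  iSup_le fun H => iSup_le fun _ => iSup_le fun _ => iSup_le fun _ => iSup_le fun X =>
    iSup_le fun hX => h H X hX

/-- Multiplication by the scalar coefficient `a_α`, the linear map describing a scalar series. -/
noncomputable def coeffMap (a : Words n → ℂ) (H : Type u) [NormedAddCommGroup H]
    [InnerProductSpace ℂ H] (α : Words n) : (H →L[ℂ] H) →ₗ[ℂ] (H →L[ℂ] H) :=
  a α • LinearMap.id

theorem bohr_scalar {a : Words n → ℂ} (ha : MemHardy.{u} a) {X : Tuple n H}
    (hX : X ∈ (1 / 3 : ℂ) • polyball n H) :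
    ∑' m : ℕ, ‖homPart a X m‖ₑ ≤ supNorm.{u} a ∧
      (¬ IsConstant.{u} a → ∑' m : ℕ, ‖homPart a X m‖ₑ < supNorm.{u} a) := by
  obtain ⟨Y, hY, rfl⟩ := Set.mem_smul_set.1 hX
  obtain ⟨hhol, hfin⟩ := ha
  have hM := ENNReal.ofReal_toReal hfin.ne
  set M := (supNorm.{u} a).toReal
  have hM0 : 0 ≤ M := ENNReal.toReal_nonneg
  have hs : ∀ (H : Type u) [NormedAddCommGroup H] [InnerProductSpace ℂ H] [CompleteSpace H],
      ∀ X ∈ polyball n H, ∀ w : ℂ, ‖w‖ = 1 →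
        Summable (multidegreePart (coeffMap a H) (w • X)) :=
    fun H _ _ _ X hX w hw => hhol H _ (smul_mem_polyball hw hX)
  have hb : ∀ (H : Type u) [NormedAddCommGroup H] [InnerProductSpace ℂ H] [CompleteSpace H],
      ∀ X ∈ polyball n H, ∀ w : ℂ, ‖w‖ = 1 →
        ‖∑' p, multidegreePart (coeffMap a H) (w • X) p‖ ≤ M :=
    fun H _ _ _ X hX w hw => norm_value_le hfin (smul_mem_polyball hw hX)
  have h1 : ∀ (H : Type u) [NormedAddCommGroup H] [InnerProductSpace ℂ H] [CompleteSpace H],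
      coeffMap a H 1 (1 : H →L[ℂ] H) = a 1 • 1 := fun H _ _ _ => rfl
  -- Evaluate at the origin of a nontrivial Hilbert space in the given universe.
  have haM : ‖a 1‖ ≤ M := by
    have h := norm_value_le hfin (zero_mem_polyball (n := n) (H := EuclideanSpace ℂ PUnit.{u + 1}))
    have h2 : value a (0 : Tuple n (EuclideanSpace ℂ PUnit.{u + 1})) = a 1 • 1 :=
      tsum_multidegreePart_zero (coeffMap a _)
    rwa [h2, norm_smul, norm_one, mul_one] at h
  rw [← hM]
  refine ⟨tsum_enorm_degreePart_third_le (hs H Y hY) hM0 (hb H Y hY) (h1 H) fun _ => haM,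
    fun hc => ?_⟩
  refine tsum_enorm_degreePart_third_lt (hs H Y hY) (hb H Y hY) (h1 H) ?_
  have hMpos : 0 < M := hM0.lt_of_ne fun h0 => hc ⟨0, fun H _ _ _ X hX => by
    rw [zero_smul]
    exact norm_le_zero_iff.1 ((norm_value_le hfin hX).trans h0.ge)⟩
  exact haM.lt_of_ne fun h => hc ⟨a 1, fun H _ _ _ X hX =>
    tsum_multidegreePart_eq (hs H X hX) hMpos (hb H X hX) (h1 H) h⟩

/-- Bohr's inequality extends to the closed ball since homogeneous parts are continuous. -/
theorem bohr_scalar_closure {a : Words n → ℂ} (ha : MemHardy.{u} a) {X : Tuple n H}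
    (hX : X ∈ (1 / 3 : ℂ) • closure (polyball n H)) :
    ∑' m : ℕ, ‖homPart a X m‖ₑ ≤ supNorm.{u} a := by
  obtain ⟨Y, hY, rfl⟩ := Set.mem_smul_set.1 hX
  refine ENNReal.tsum_le_of_sum_range_le fun N => ?_
  have hcont : ∀ m, Continuous fun Y : Tuple n H => homPart a ((1 / 3 : ℂ) • Y) m := fun m =>
    (continuous_finsetSum _ fun α _ => (continuous_monomial α).const_smul (a α)).comp
      (continuous_const_smul _)
  have hclosed : IsClosed {Y : Tuple n H |
      ∑ m ∈ range N, ‖homPart a ((1 / 3 : ℂ) • Y) m‖ₑ ≤ supNorm.{u} a} :=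
    isClosed_le (continuous_finsetSum _ fun m _ => (hcont m).enorm) continuous_const
  refine closure_minimal (fun Y hY => ?_) hclosed hY
  exact (ENNReal.sum_le_tsum _).trans (bohr_scalar ha (Set.smul_mem_smul_set hY)).1

end Scalar

/-! ### Möbius transforms of contractions -/

/-- The Taylor coefficients of the disc automorphism `z ↦ (a - z) / (1 - a z)`. -/
noncomputable def mobiusCoeff (a : ℝ) : ℕ → ℝ
  | 0 => a
  | m + 1 => -((1 - a ^ 2) * a ^ m)

/-- Von Neumann's inequality for the disc automorphism `z ↦ (a - z) / (1 - a z)`. -/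
theorem hasSum_mobiusCoeff_smul_pow {H : Type*} [NormedAddCommGroup H] [InnerProductSpace ℂ H]
    [CompleteSpace H] {a : ℝ} (ha0 : 0 ≤ a) (ha1 : a < 1) {T : H →L[ℂ] H} (hT : ‖T‖ < 1) :
    ∃ S : H →L[ℂ] H, HasSum (fun m => (mobiusCoeff a m : ℂ) • T ^ m) S ∧ ‖S‖ ≤ 1 := by
  set U : H →L[ℂ] H := (a : ℂ) • T with hU
  have hU1 : ‖U‖ < 1 := by
    rw [hU, norm_smul, Complex.norm_real, Real.norm_of_nonneg ha0]
    nlinarith [norm_nonneg T]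
  set R : H →L[ℂ] H := ∑' m, U ^ m with hR
  have hRsum : HasSum (fun m => U ^ m) R := (summable_geometric_of_norm_lt_one hU1).hasSum
  have h1 : (1 - U) * R = 1 := mul_neg_geom_series U hU1
  set S : H →L[ℂ] H := (a : ℂ) • 1 - ((1 - a ^ 2 : ℝ) : ℂ) • (T * R) with hS
  have hsum : HasSum (fun m => (mobiusCoeff a m : ℂ) • T ^ m) S := by
    rw [← hasSum_nat_add_iff' 1]
    have h2 := (hRsum.mul_left T).const_smul (-((1 - a ^ 2 : ℝ) : ℂ))
    have h3 : ∀ m, -((1 - a ^ 2 : ℝ) : ℂ) • (T * U ^ m) =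
        (mobiusCoeff a (m + 1) : ℂ) • T ^ (m + 1) := fun m => by
      rw [hU, smul_pow, mul_smul_comm, smul_smul, ← pow_succ']
      congr 1
      simp only [mobiusCoeff]
      push_cast; ring
    have h4 : -((1 - a ^ 2 : ℝ) : ℂ) • (T * R) =
        S - ∑ m ∈ range 1, (mobiusCoeff a m : ℂ) • T ^ m := by
      rw [sum_range_one, hS, mobiusCoeff, pow_zero, neg_smul]
      abel
    simp only [h3, h4] at h2
    exact h2
  refine ⟨S, hsum, ContinuousLinearMap.opNorm_le_bound _ zero_le_one fun x => ?_⟩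
  -- With `x = (1 - a T) y` one has `S x = (a - T) y`.
  obtain ⟨y, hy⟩ : ∃ y, y = R x := ⟨_, rfl⟩
  have hx : x = y - (a : ℂ) • T y := by
    have := congrArg (fun f : H →L[ℂ] H => f x) h1
    simpa [hU, hy] using this.symm
  have hSx : S x = (a : ℂ) • y - T y := by
    have : S x = (a : ℂ) • x - ((1 - a ^ 2 : ℝ) : ℂ) • T y := by simp [hS, hy]
    rw [this]
    nth_rewrite 1 [hx]
    push_cast
    module
  have hTy : ‖T y‖ ≤ ‖y‖ := (T.le_of_opNorm_le hT.le y).trans_eq (one_mul _)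
  rw [one_mul, hSx]
  rw [hx]
  refine le_of_sq_le_sq ?_ (norm_nonneg _)
  rw [norm_sub_sq (𝕜 := ℂ), norm_sub_sq (𝕜 := ℂ), inner_smul_left, inner_smul_right, norm_smul,
    norm_smul, Complex.norm_real, Real.norm_of_nonneg ha0, Complex.conj_ofReal]
  nlinarith [mul_nonneg (sub_nonneg.2 (pow_le_one₀ (n := 2) ha0 ha1.le))
    (sub_nonneg.2 (pow_le_pow_left₀ (norm_nonneg _) hTy 2))]

/-- The majorant series of the disc automorphism exceeds `1` at every `ρ > 1 / (1 + 2 a)`. -/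
theorem one_lt_tsum_mobiusCoeff {a ρ : ℝ} (ha0 : 0 ≤ a) (ha1 : a < 1) (hρ0 : 0 ≤ ρ) (hρ1 : ρ < 1)
    (h : 1 < ρ * (1 + 2 * a)) :
    1 < ∑' m, ENNReal.ofReal (|mobiusCoeff a m| * ρ ^ m) := by
  have haρ : a * ρ < 1 := by nlinarith
  have hD : 0 ≤ 1 - a ^ 2 := by nlinarith
  have hterm : ∀ m, |mobiusCoeff a (m + 1)| * ρ ^ (m + 1) = (1 - a ^ 2) * ρ * (a * ρ) ^ m := by
    intro m
    rw [mobiusCoeff, abs_neg, abs_of_nonneg (by positivity)]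
    ring
  have hg : HasSum (fun m : ℕ => (1 - a ^ 2) * ρ * (a * ρ) ^ m)
      ((1 - a ^ 2) * ρ * (1 - a * ρ)⁻¹) :=
    (hasSum_geometric_of_lt_one (by positivity) haρ).mul_left _
  rw [tsum_eq_zero_add' ENNReal.summable]
  simp only [hterm]
  rw [← ENNReal.ofReal_tsum_of_nonneg (fun m => by positivity) hg.summable, hg.tsum_eq, mobiusCoeff,
    pow_zero, mul_one, abs_of_nonneg ha0, ← ENNReal.ofReal_add ha0 (by
      have : 0 < (1 - a * ρ)⁻¹ := inv_pos.2 (by linarith)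
      positivity), ← ENNReal.ofReal_one, ENNReal.ofReal_lt_ofReal_iff_of_nonneg zero_le_one,
    ← div_eq_mul_inv, ← sub_lt_iff_lt_add', lt_div_iff₀ (by linarith)]
  nlinarith

/-! ### Sharpness of the radius -/

section Sharpness

variable {k : ℕ} {n : Fin k → ℕ} (i₀ : Fin k) (j₀ : Fin (n i₀))

/-- The multi-word whose only nontrivial component is the `m`-th power of the generator `j₀` of
the `i₀`-th free monoid. -/
def powerWord (m : ℕ) : Words n := Pi.mulSingle i₀ (FreeMonoid.of j₀ ^ m)

theorem length_powerWord (m : ℕ) (i : Fin k) :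
    (powerWord i₀ j₀ m i).length = (Pi.single i₀ m : Fin k → ℕ) i := by
  by_cases h : i = i₀
  · subst h
    induction m with
    | zero => simp [powerWord]
    | succ m ih =>
      simp only [powerWord, Pi.mulSingle_eq_same, Pi.single_eq_same] at ih ⊢
      rw [pow_succ, FreeMonoid.length_mul, ih, FreeMonoid.length_of]
  · simp [powerWord, h]

theorem sum_length_powerWord (m : ℕ) : ∑ i, (powerWord i₀ j₀ m i).length = m := by
  simp only [length_powerWord, sum_pi_single', mem_univ, if_true]

open Classical in
/-- The coefficients of the one-variable power series `∑ c_m X_{i₀,j₀} ^ m`. -/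
noncomputable def oneVariable (c : ℕ → ℂ) (α : Words n) : ℂ :=
  if α = powerWord i₀ j₀ (∑ i, (α i).length) then c (∑ i, (α i).length) else 0

variable {H : Type u} [NormedAddCommGroup H] [InnerProductSpace ℂ H]

theorem monomial_powerWord (X : Tuple n H) (m : ℕ) :
    monomial X (powerWord i₀ j₀ m) = X i₀ j₀ ^ m := by
  rw [monomial, prod_ofFn_eq_of_forall_ne _ i₀]
  · simp [powerWord]
  · intro j hj
    simp [powerWord, hj]

theorem sum_oneVariable (c : ℕ → ℂ) (X : Tuple n H) (m : ℕ) (s : Finset (Words n))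
    (hs : ∀ α ∈ s, ∑ i, (α i).length = m) (hm : powerWord i₀ j₀ m ∈ s) :
    ∑ α ∈ s, oneVariable i₀ j₀ c α • monomial X α = c m • X i₀ j₀ ^ m := by
  rw [sum_eq_single_of_mem _ hm, oneVariable, sum_length_powerWord, if_pos rfl, monomial_powerWord]
  intro α hα hne
  rw [oneVariable, hs α hα, if_neg hne, zero_smul]

theorem homPart_oneVariable (c : ℕ → ℂ) (X : Tuple n H) (m : ℕ) :
    Scalar.homPart (oneVariable i₀ j₀ c) X m = c m • X i₀ j₀ ^ m :=
  sum_oneVariable i₀ j₀ c X m _ (fun _ => mem_Gam.1) (mem_Gam.2 (sum_length_powerWord i₀ j₀ m))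

theorem multiHomPart_oneVariable (c : ℕ → ℂ) (X : Tuple n H) (m : ℕ) :
    Scalar.multiHomPart (oneVariable i₀ j₀ c) X (Pi.single i₀ m) = c m • X i₀ j₀ ^ m := by
  refine sum_oneVariable i₀ j₀ c X m _ (fun α hα => ?_) (mem_Lam.2 (length_powerWord i₀ j₀ m))
  simp only [mem_Lam.1 hα, sum_pi_single', mem_univ, if_true]

theorem multiHomPart_oneVariable_of_notMem (c : ℕ → ℂ) (X : Tuple n H) {p : Fin k → ℕ}
    (hp : p ∉ Set.range fun m : ℕ => (Pi.single i₀ m : Fin k → ℕ)) :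
    Scalar.multiHomPart (oneVariable i₀ j₀ c) X p = 0 := by
  refine sum_eq_zero fun α hα => ?_
  rw [oneVariable, if_neg, zero_smul]
  intro h
  refine hp ⟨∑ i, (α i).length, funext fun i => ?_⟩
  rw [← mem_Lam.1 hα i]
  exact (length_powerWord i₀ j₀ _ i).symm.trans (congrArg (fun β : Words n => (β i).length) h.symm)

theorem hasSum_multiHomPart_oneVariable {c : ℕ → ℂ} {X : Tuple n H} {S : H →L[ℂ] H}
    (h : HasSum (fun m => c m • X i₀ j₀ ^ m) S) :
    HasSum (Scalar.multiHomPart (oneVariable i₀ j₀ c) X) S := by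
  refine ((Pi.single_injective i₀).hasSum_iff
    fun p hp => multiHomPart_oneVariable_of_notMem i₀ j₀ c X hp).1 ?_
  simpa only [Function.comp_def, multiHomPart_oneVariable] using h

/-- The point of the polyball with the single nonzero entry `s I`. -/
noncomputable def scalarPoint (H : Type u) [NormedAddCommGroup H] [InnerProductSpace ℂ H]
    (s : ℝ) : Tuple n H :=
  Pi.single i₀ (Pi.single j₀ ((s : ℂ) • 1))

theorem scalarPoint_apply (s : ℝ) : scalarPoint i₀ j₀ H s i₀ j₀ = (s : ℂ) • 1 := by
  simp [scalarPoint]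

variable {K : Type v} [NormedAddCommGroup K] [InnerProductSpace ℂ K]

theorem sum_opTensor_smul_one (a : Words n → ℂ) (X : Tuple n H) (s : Finset (Words n)) :
    ∑ α ∈ s, opTensor (a α • (1 : K →L[ℂ] K)) (monomial X α) =
      opTensor 1 (∑ α ∈ s, a α • monomial X α) := by
  have h := map_sum (opTensorLin (1 : K →L[ℂ] K)) (fun α => a α • monomial X α) s
  refine Eq.trans (sum_congr rfl fun α _ => ?_) h.symm
  rw [smul_opTensor]
  exact (opTensor_smul _ _ _).symm

theorem homPart_mobius_scalarPoint (c : ℕ → ℂ) (ρ : ℝ) (m : ℕ) :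
    Scalar.homPart (oneVariable i₀ j₀ c) (scalarPoint i₀ j₀ H ρ) m =
      (c m * (ρ : ℂ) ^ m) • 1 := by
  rw [homPart_oneVariable, scalarPoint_apply, smul_pow, one_pow, smul_smul]

theorem hasSum_multiHomPart_smul_one {a : Words n → ℂ} {X : Tuple n H} {S : H →L[ℂ] H}
    (h : HasSum (Scalar.multiHomPart a X) S) :
    HasSum (multiHomPart (fun α => a α • (1 : K →L[ℂ] K)) X) (opTensor 1 S) := by
  have h' := h.map (opTensorLin (1 : K →L[ℂ] K)) (continuous_opTensor 1)
  have hcomp : multiHomPart (fun α => a α • (1 : K →L[ℂ] K)) X =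
      opTensorLin (1 : K →L[ℂ] K) ∘ Scalar.multiHomPart a X :=
    funext fun p => sum_opTensor_smul_one a X _
  rw [hcomp]
  exact h'

variable [CompleteSpace H]

theorem norm_lt_one_of_mem_polyball {X : Tuple n H} (hX : X ∈ polyball n H) : ‖X i₀ j₀‖ < 1 := by
  have h1 := hX.2.1 i₀
  rw [Real.sqrt_lt' one_pos, one_pow] at h1
  have h2 : ‖X i₀ j₀ * star (X i₀ j₀)‖ ≤ ‖∑ j, X i₀ j * star (X i₀ j)‖ :=
    CStarAlgebra.norm_le_norm_of_nonneg_of_le (mul_star_self_nonneg _)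
      (single_le_sum (f := fun j => X i₀ j * star (X i₀ j)) (fun j _ => mul_star_self_nonneg _)
        (mem_univ j₀))
  rw [CStarRing.norm_self_mul_star] at h2
  nlinarith [norm_nonneg (X i₀ j₀)]

theorem Phi_scalarPoint (s : ℝ) :
    Phi (scalarPoint i₀ j₀ H s i₀) 1 = ((s ^ 2 : ℝ) : ℂ) • 1 := by
  change ∑ j, scalarPoint i₀ j₀ H s i₀ j * 1 * star (scalarPoint i₀ j₀ H s i₀ j) = _
  rw [sum_eq_single_of_mem j₀ (mem_univ _)]
  · rw [scalarPoint_apply, mul_one, star_smul, star_one, smul_mul_smul_comm, one_mul, sq,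
      Complex.ofReal_mul, Complex.star_def, Complex.conj_ofReal]
  · intro j _ hj
    simp [scalarPoint, hj]

theorem scalarPoint_mem_polyball {s : ℝ} (hs0 : 0 ≤ s) (hs1 : s < 1) :
    scalarPoint i₀ j₀ H s ∈ polyball n H := by
  have hz : ∀ i, i ≠ i₀ → scalarPoint i₀ j₀ H s i = 0 := fun i hi => by
    rw [scalarPoint, Pi.single_eq_of_ne hi]
  have hs2 : s ^ 2 < 1 := by nlinarith
  have hD : Defect (scalarPoint i₀ j₀ H s) 1 = ((1 - s ^ 2 : ℝ) : ℂ) • 1 := by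
    rw [Defect, prod_ofFn_eq_of_forall_ne _ i₀]
    · rw [LinearMap.sub_apply, LinearMap.id_apply, Phi_scalarPoint, Complex.ofReal_sub, sub_smul,
        Complex.ofReal_one, one_smul]
    · intro i hi
      rw [hz i hi, Phi_zero, sub_zero]; rfl
  refine ⟨fun i i' hii i1 i2 => ?_, fun i => ?_, ?_, ?_⟩
  · by_cases h : i = i₀
    · rw [hz i' fun h' => hii (h.trans h'.symm)]; simp
    · rw [hz i h]; simp
  · by_cases h : i = i₀
    · subst h
      have h1 : ∑ j, scalarPoint i j₀ H s i j * star (scalarPoint i j₀ H s i j) =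
          ((s ^ 2 : ℝ) : ℂ) • 1 := by
        rw [← Phi_scalarPoint i j₀]
        simp [Phi]
      rw [h1, Real.sqrt_lt' one_pos, norm_smul, Complex.norm_real, Real.norm_of_nonneg (sq_nonneg s),
        one_pow]
      have : ‖(1 : H →L[ℂ] H)‖ ≤ 1 := ContinuousLinearMap.norm_id_le
      nlinarith [norm_nonneg (1 : H →L[ℂ] H), sq_nonneg s]
    · rw [hz i h]; simp
  · rw [hD]
    exact ContinuousLinearMap.isPositive_one.smul_of_nonneg
      (Complex.zero_le_real.2 (by linarith))
  · rw [hD]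
    exact isUnit_one.smul (Units.mk0 _ (Complex.ofReal_ne_zero.2 (by linarith)))

/-- As `a → 1` the condition `1 < ρ (1 + 2 a)` becomes `ρ > 1 / 3`, so any `ρ` strictly between
`1 / 3` and `min r 1` works for `a` close to `1`. -/
theorem exists_mobius_parameters {r : ℝ} (hr : 1 / 3 < r) :
    ∃ a ρ : ℝ, 0 ≤ a ∧ a < 1 ∧ 0 ≤ ρ ∧ ρ < 1 ∧ ρ < r ∧ 1 < ρ * (1 + 2 * a) := by
  obtain ⟨ρ, h1, h2⟩ := exists_between (lt_min hr (by norm_num : (1 / 3 : ℝ) < 1))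
  obtain ⟨hρr, hρ1⟩ := lt_min_iff.1 h2
  have hρ0 : 0 < ρ := by linarith
  have h3 : (1 / ρ - 1) / 2 < 1 := by
    have : 1 / ρ < 3 := by rw [div_lt_iff₀ hρ0]; linarith
    linarith
  obtain ⟨a, ha, ha1⟩ := exists_between h3
  have h4 : 1 < 1 / ρ := by rw [lt_div_iff₀ hρ0]; linarith
  refine ⟨a, ρ, by linarith, ha1, hρ0.le, hρ1, hρr, ?_⟩
  have h5 : 1 / ρ < 1 + 2 * a := by linarith
  rwa [div_lt_iff₀ hρ0, mul_comm] at h5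

/-- The point with single entry `ρ I` is `r` times the one with entry `(ρ / r) I`, and `ρ / r < 1`. -/
theorem smul_scalarPoint_mem {r ρ : ℝ} (hρ0 : 0 ≤ ρ) (hρr : ρ < r) :
    scalarPoint i₀ j₀ H ρ ∈ (r : ℂ) • polyball n H := by
  have hr : 0 < r := hρ0.trans_lt hρr
  refine Set.mem_smul_set.2 ⟨scalarPoint i₀ j₀ H (ρ / r),
    scalarPoint_mem_polyball i₀ j₀ (by positivity) ((div_lt_one hr).2 hρr), ?_⟩
  rw [scalarPoint, scalarPoint, ← Pi.single_smul, ← Pi.single_smul, smul_smul,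
    ← Complex.ofReal_mul, mul_div_cancel₀ _ hr.ne']

theorem exists_hasSum_mobius {a : ℝ} (ha0 : 0 ≤ a) (ha1 : a < 1) {X : Tuple n H}
    (hX : X ∈ polyball n H) :
    ∃ S : H →L[ℂ] H, HasSum
      (Scalar.multiHomPart (oneVariable i₀ j₀ fun m => (mobiusCoeff a m : ℂ)) X) S ∧ ‖S‖ ≤ 1 := by
  obtain ⟨S, hS, hS1⟩ :=
    hasSum_mobiusCoeff_smul_pow ha0 ha1 (norm_lt_one_of_mem_polyball i₀ j₀ hX)
  exact ⟨S, hasSum_multiHomPart_oneVariable i₀ j₀ hS, hS1⟩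

theorem enorm_le_one {E : Type*} [NormedAddCommGroup E] [InnerProductSpace ℂ E] {T : E →L[ℂ] E}
    (h : ‖T‖ ≤ 1) : ‖T‖ₑ ≤ 1 := by
  rw [← ofReal_norm]
  exact ENNReal.ofReal_le_one.2 h

theorem enorm_smul_one {E : Type*} [NormedAddCommGroup E] [InnerProductSpace ℂ E] [Nontrivial E]
    (z : ℂ) : ‖z • (1 : E →L[ℂ] E)‖ₑ = ENNReal.ofReal ‖z‖ := by
  rw [← ofReal_norm, norm_smul, norm_one, mul_one]

theorem norm_mobiusCoeff_mul_pow (a : ℝ) {ρ : ℝ} (hρ0 : 0 ≤ ρ) (m : ℕ) :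
    ‖(mobiusCoeff a m : ℂ) * (ρ : ℂ) ^ m‖ = |mobiusCoeff a m| * ρ ^ m := by
  rw [norm_mul, norm_pow, Complex.norm_real, Complex.norm_real, Real.norm_eq_abs,
    Real.norm_of_nonneg hρ0]

theorem sharp_scalar (hn : ∀ i, 0 < n i) (hk : 0 < k) [Nontrivial H] {r : ℝ} (hr : 1 / 3 < r) :
    ∃ a : Words n → ℂ, Scalar.MemHardy.{u} a ∧ ∃ X ∈ (r : ℂ) • polyball n H,
      Scalar.supNorm.{u} a < ∑' m : ℕ, ‖Scalar.homPart a X m‖ₑ := by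
  obtain ⟨a, ρ, ha0, ha1, hρ0, hρ1, hρr, h⟩ := exists_mobius_parameters hr
  let i₀ : Fin k := ⟨0, hk⟩
  let j₀ : Fin (n i₀) := ⟨0, hn i₀⟩
  have hsup : Scalar.supNorm.{u} (oneVariable i₀ j₀ fun m => (mobiusCoeff a m : ℂ)) ≤ 1 :=
    Scalar.supNorm_le fun H _ _ _ X hX => by
      obtain ⟨S, hS, hS1⟩ := exists_hasSum_mobius i₀ j₀ ha0 ha1 hX
      rw [Scalar.value, hS.tsum_eq]
      exact enorm_le_one hS1
  refine ⟨_, ⟨fun H _ _ _ X hX => ?_, hsup.trans_lt ENNReal.one_lt_top⟩, scalarPoint i₀ j₀ H ρ,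
    smul_scalarPoint_mem i₀ j₀ hρ0 hρr, hsup.trans_lt ?_⟩
  · obtain ⟨S, hS, -⟩ := exists_hasSum_mobius i₀ j₀ ha0 ha1 hX
    exact hS.summable
  · simp only [homPart_mobius_scalarPoint, enorm_smul_one, norm_mobiusCoeff_mul_pow a hρ0]
    exact one_lt_tsum_mobiusCoeff ha0 ha1 hρ0 hρ1 h

theorem sharp_operator (hn : ∀ i, 0 < n i) (hk : 0 < k) [Nontrivial K] [Nontrivial H] {r : ℝ}
    (hr : 1 / 3 < r) :
    ∃ A : Words n → (K →L[ℂ] K), IsBoundedFreeHolomorphic.{u, v} A ∧ IsScalarAtZero.{u, v} A ∧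
      ∃ X ∈ (r : ℂ) • polyball n H, supNorm.{u, v} A < ∑' m : ℕ, ‖homPart A X m‖ₑ := by
  obtain ⟨a, ρ, ha0, ha1, hρ0, hρ1, hρr, h⟩ := exists_mobius_parameters hr
  let i₀ : Fin k := ⟨0, hk⟩
  let j₀ : Fin (n i₀) := ⟨0, hn i₀⟩
  set c := oneVariable i₀ j₀ fun m => (mobiusCoeff a m : ℂ) with hc
  have hsup : supNorm.{u, v} (fun α => c α • (1 : K →L[ℂ] K)) ≤ 1 :=
    supNorm_le fun H _ _ _ X hX => by
      obtain ⟨S, hS, hS1⟩ := exists_hasSum_mobius i₀ j₀ ha0 ha1 hX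
      have hv : value (fun α => c α • (1 : K →L[ℂ] K)) X = opTensor 1 S :=
        (hasSum_multiHomPart_smul_one hS).tsum_eq
      rw [hv]
      refine enorm_le_one ((norm_opTensor_le _ _).trans ?_)
      exact mul_le_one₀ ContinuousLinearMap.norm_id_le (norm_nonneg _) hS1
  refine ⟨fun α => c α • 1, ⟨fun H _ _ _ X hX => ?_, hsup.trans_lt ENNReal.one_lt_top⟩,
    ⟨c 1, fun H _ _ _ => ?_⟩, scalarPoint i₀ j₀ H ρ,
    smul_scalarPoint_mem i₀ j₀ hρ0 hρr, hsup.trans_lt ?_⟩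
  · obtain ⟨S, hS, -⟩ := exists_hasSum_mobius i₀ j₀ ha0 ha1 hX
    exact (hasSum_multiHomPart_smul_one hS).summable
  · refine (tsum_multidegreePart_zero fun α => opTensorLin (c α • (1 : K →L[ℂ] K))).trans ?_
    refine (smul_opTensor _ _ _).trans ?_
    rw [opTensor_one_one]
  · have := nontrivial_hTensor (K := K) (H := H)
    have hpart : ∀ m, ‖homPart (fun α => c α • (1 : K →L[ℂ] K)) (scalarPoint i₀ j₀ H ρ) m‖ₑ =
        ENNReal.ofReal (|mobiusCoeff a m| * ρ ^ m) := fun m => by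
      have h1 : homPart (fun α => c α • (1 : K →L[ℂ] K)) (scalarPoint i₀ j₀ H ρ) m =
          ((mobiusCoeff a m : ℂ) * (ρ : ℂ) ^ m) • 1 := by
        refine (sum_opTensor_smul_one c _ _).trans ?_
        refine (congrArg (opTensor 1) (homPart_mobius_scalarPoint i₀ j₀ _ ρ m)).trans ?_
        rw [opTensor_smul, opTensor_one_one]
      rw [h1, ← norm_mobiusCoeff_mul_pow a hρ0]
      exact enorm_smul_one _
    simp only [hpart]
    exact one_lt_tsum_mobiusCoeff ha0 ha1 hρ0 hρ1 h

/-- Radius `1 / 3` is admissible by continuity up to the closed ball; a larger one is excluded already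
on a one-dimensional space, which exists in every universe. -/
theorem isGreatest_bohrSet (hn : ∀ i, 0 < n i) (hk : 0 < k) :
    IsGreatest (bohrSet.{u} n) (1 / 3) := by
  refine ⟨⟨by norm_num, fun a ha H _ _ _ X hX => Scalar.bohr_scalar_closure ha ?_⟩,
    fun r hr => ?_⟩
  · simpa using hX
  · by_contra! hlt
    obtain ⟨a, ha, X, hX, h⟩ :=
      sharp_scalar (H := EuclideanSpace ℂ PUnit.{u + 1}) hn hk hlt
    exact h.not_ge (hr.2 a ha _ X (Set.smul_set_mono subset_closure hX))

end Sharpness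

end RegularPolyball

theorem mainTheorem3 {k : ℕ} (hk : 0 < k) (n : Fin k → ℕ) (hn : ∀ i, 0 < n i) :
    -- operator coefficients, scalar value at the origin
    (∀ (K : Type v) [NormedAddCommGroup K] [InnerProductSpace ℂ K] [CompleteSpace K],
      (∀ A : RegularPolyball.Words n → (K →L[ℂ] K),
        RegularPolyball.IsBoundedFreeHolomorphic.{u, v} A →
        RegularPolyball.IsScalarAtZero.{u, v} A →
        ∀ (H : Type u) [NormedAddCommGroup H] [InnerProductSpace ℂ H] [CompleteSpace H],
          ∀ X ∈ (1 / 3 : ℂ) • RegularPolyball.polyball n H,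
            ∑' m : ℕ, ‖RegularPolyball.homPart A X m‖ₑ ≤ RegularPolyball.supNorm.{u, v} A ∧
            (¬ RegularPolyball.IsConstant.{u, v} A →
              ∑' m : ℕ, ‖RegularPolyball.homPart A X m‖ₑ < RegularPolyball.supNorm.{u, v} A)) ∧
      -- the constant 1/3 cannot be replaced by a larger one
      (Nontrivial K →
        ∀ (H : Type u) [NormedAddCommGroup H] [InnerProductSpace ℂ H] [CompleteSpace H]
          [Nontrivial H], ∀ r : ℝ, 1 / 3 < r →
          ∃ A : RegularPolyball.Words n → (K →L[ℂ] K),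
            RegularPolyball.IsBoundedFreeHolomorphic.{u, v} A ∧
            RegularPolyball.IsScalarAtZero.{u, v} A ∧
            ∃ X ∈ (r : ℂ) • RegularPolyball.polyball n H,
              RegularPolyball.supNorm.{u, v} A <
                ∑' m : ℕ, ‖RegularPolyball.homPart A X m‖ₑ)) ∧
    -- scalar coefficients
    ((∀ a : RegularPolyball.Words n → ℂ, RegularPolyball.Scalar.MemHardy.{u} a →
        ∀ (H : Type u) [NormedAddCommGroup H] [InnerProductSpace ℂ H] [CompleteSpace H],
          ∀ X ∈ (1 / 3 : ℂ) • RegularPolyball.polyball n H,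
            ∑' m : ℕ, ‖RegularPolyball.Scalar.homPart a X m‖ₑ ≤
              RegularPolyball.Scalar.supNorm.{u} a ∧
            (¬ RegularPolyball.Scalar.IsConstant.{u} a →
              ∑' m : ℕ, ‖RegularPolyball.Scalar.homPart a X m‖ₑ <
                RegularPolyball.Scalar.supNorm.{u} a)) ∧
      (∀ (H : Type u) [NormedAddCommGroup H] [InnerProductSpace ℂ H] [CompleteSpace H]
        [Nontrivial H], ∀ r : ℝ, 1 / 3 < r →
        ∃ a : RegularPolyball.Words n → ℂ, RegularPolyball.Scalar.MemHardy.{u} a ∧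
          ∃ X ∈ (r : ℂ) • RegularPolyball.polyball n H,
            RegularPolyball.Scalar.supNorm.{u} a <
              ∑' m : ℕ, ‖RegularPolyball.Scalar.homPart a X m‖ₑ)) ∧
    -- the Bohr radius is attained as a largest radius, and equals 1/3
    IsGreatest (RegularPolyball.bohrSet.{u} n) (RegularPolyball.bohrRadius.{u} n) ∧
    RegularPolyball.bohrRadius.{u} n = 1 / 3 := by
  have hgreatest := RegularPolyball.isGreatest_bohrSet.{u} hn hk
  have hradius : RegularPolyball.bohrRadius.{u} n = 1 / 3 := hgreatest.csSup_eq
  refine ⟨fun K _ _ _ => ⟨fun A hA hA0 H _ _ _ X hX => RegularPolyball.bohr_operator hA hA0 hX,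
    fun _ H _ _ _ _ r hr => RegularPolyball.sharp_operator hn hk hr⟩,
    ⟨fun a ha H _ _ _ X hX => RegularPolyball.Scalar.bohr_scalar ha hX,
      fun H _ _ _ _ r hr => RegularPolyball.sharp_scalar hn hk hr⟩, ?_, hradius⟩
  rw [hradius]
  exact hgreatest
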